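/- **Theorem.** Bi-modal formulas are built from a set $Var$ of propositional variables with $\bot,\wedge,\vee,\to,\square,\Diamond$, where $\neg\varphi:=\varphi\to\bot$. A GK-model is a triple $M=\langle W,S,e\rangle$ with $W\neq\emptyset$ and arbitrary functions $S:W\times W\to[0,1]$, $e:W\times Var\to[0,1]$; the pair $\langle W,S\rangle$ is its frame. Let $a\Rightarrow b$ be $1$ if $a\le b$ and $b$ otherwise. Extend $e$ to all formulas by interpreting $\bot,\wedge,\vee,\to$ at each world as $0,\min,\max,\Rightarrow$, and $$e(x,\square\varphi)=\inf_{y\in W}\bigl(S(x,y)\Rightarrow e(y,\varphi)\bigr),\qquad e(x,\Diamond\varphi)=\sup_{y\in W}\min\bigl(S(x,y),e(y,\varphi)\bigr).$$ A frame is reflexive if $S(x,x)=1$ for all $x$, transitive if $\min(S(x,y),S(y,z))\le S(x,z)$ for all $x,y,z$, and symmetric if $S(x,y)=S(y,x)$ for all $x,y$; $Ref$, $Trans$, $Symm$ are the classes of GK-models over such frames. For a class $\mathcal C$ of GK-models, $T\models_{\mathcal C}\varphi$ means: for every $M\in\mathcal C$ and every world $x$ of $M$, if $e(x,\theta)=1$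 for all $\theta\in T$, then $e(x,\varphi)=1$. Let $\mathcal G_{\square\Diamond}$ be Heyting propositional calculus with modus ponens and the prelinearity axiom $(\varphi\to\psi)\vee(\psi\to\varphi)$, together with the axiom schemes $\square(\varphi\to\psi)\to(\square\varphi\to\square\psi)$, $\Diamond(\varphi\vee\psi)\to(\Diamond\varphi\vee\Diamond\psi)$, $\neg\Diamond\bot$, $\Diamond(\varphi\to\psi)\to(\square\varphi\to\Diamond\psi)$, $(\Diamond\varphi\to\square\psi)\to\square(\varphi\to\psi)$ and the rules "from $\varphi$ infer $\square\varphi$" and "from $\varphi\to\psi$ infer $\Diamond\varphi\to\Diamond\psi$". Let * $\mathcal GT_{\square\Diamond}$ be $\mathcal G_{\square\Diamond}$ plus the axiom schemes $\square\varphi\to\varphi$ and $\varphi\to\Diamond\varphi$; * $\mathcal GS4_{\square\Diamond}$ be $\mathcal GT_{\square\Diamond}$ plus $\square\varphi\to\square\square\varphi$ and $\Diamond\Diamond\varphi\to\Diamond\varphi$; * $\mathcal GS5_{\square\Diamond}$ be $\mathcal GS4_{\square\Diamond}$ plus $\varphi\to\square\Diamond\varphi$ and $\Diamond\square\varphi\to\varphi$.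 For a calculus $L$ among these, $T\vdash_L\varphi$ means that $\varphi$ is deducible in $L$ from assumptions in $T$, where the two modal rules may be applied only to theorems of $L$ (formulas deducible in $L$ without assumptions). Then for every countable set $T$ of formulas and every formula $\varphi$: 1. $T\vdash_{\mathcal GT_{\square\Diamond}}\varphi$ if and only if $T\models_{Ref}\varphi$; 2. $T\vdash_{\mathcal GS4_{\square\Diamond}}\varphi$ if and only if $T\models_{Ref\cap Trans}\varphi$; 3. $T\vdash_{\mathcal GS5_{\square\Diamond}}\varphi$ if and only if $T\models_{Ref\cap Trans\cap Symm}\varphi$. -/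

import Mathlib

universe u v

/-- Formulas of bi-modal propositional logic over a set `Var` of propositional variables. -/
inductive BiModal.Formula (Var : Type u) where
  | var (p : Var) : BiModal.Formula Var
  | bot : BiModal.Formula Var
  | and (φ ψ : BiModal.Formula Var) : BiModal.Formula Var
  | or (φ ψ : BiModal.Formula Var) : BiModal.Formula Var
  | imp (φ ψ : BiModal.Formula Var) : BiModal.Formula Var
  | box (φ : BiModal.Formula Var) : BiModal.Formula Var
  | dia (φ : BiModal.Formula Var) : BiModal.Formula Var

namespace BiModal

namespace Formula

/-- Negation `¬φ := φ → ⊥`. -/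
def neg {Var : Type u} (φ : Formula Var) : Formula Var := imp φ bot

end Formula

open Formula

/-! ### Gödel-Kripke semantics -/

/-- The Heyting implication of the interval `[0,1]` is the Gödel implication. -/
theorem unitInterval_himp_eq (a b : unitInterval) : a ⇨ b = if a ≤ b then 1 else b := by
  split_ifs with h
  · exact himp_eq_top_iff.2 h
  · refine le_antisymm ?_ le_himp
    have h0 := @himp_inf_le _ _ a b
    rcases le_total (a ⇨ b) a with h1 | h1
    · rwa [inf_eq_left.2 h1] at h0
    · rw [inf_eq_right.2 h1] at h0
      exact absurd h0 h

/-- A Gödel-Kripke model: a non-empty set of worlds, a `[0,1]`-valued accessibility relation and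
a `[0,1]`-valued evaluation of the variables at each world. -/
structure GKModel (Var : Type u) : Type (max u (v + 1)) where
  World : Type v
  nonempty : Nonempty World
  S : World → World → unitInterval
  e : World → Var → unitInterval

/-- The value of a formula at a world. The operations are those of the complete Heyting algebra
`[0,1]`. -/
noncomputable def GKModel.val {Var : Type u} (M : GKModel.{u, v} Var) :
    M.World → Formula Var → unitInterval
  | x, .var p => M.e x p
  | _, .bot => 0
  | x, .and φ ψ => M.val x φ ⊓ M.val x ψ
  | x, .or φ ψ => M.val x φ ⊔ M.val x ψ
  | x, .imp φ ψ => M.val x φ ⇨ M.val x ψ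
  | x, .box φ => ⨅ y, (M.S x y ⇨ M.val y φ)
  | x, .dia φ => ⨆ y, (M.S x y ⊓ M.val y φ)

/-- Models over reflexive frames. -/
def Ref (Var : Type u) : Set (GKModel.{u, v} Var) :=
  {M | ∀ x, M.S x x = 1}

/-- Models over transitive frames. -/
def Trans (Var : Type u) : Set (GKModel.{u, v} Var) :=
  {M | ∀ x y z, M.S x y ⊓ M.S y z ≤ M.S x z}

/-- Models over symmetric frames. -/
def Symm (Var : Type u) : Set (GKModel.{u, v} Var) :=
  {M | ∀ x y, M.S x y = M.S y x}

/-- Local entailment over a class `C` of models: in every model of `C`, the formula `φ` has value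
`1` at each world where all members of `T` have value `1`. -/
def Entails {Var : Type u} (C : Set (GKModel.{u, v} Var)) (T : Set (Formula Var))
    (φ : Formula Var) : Prop :=
  ∀ M ∈ C, ∀ x : M.World, (∀ θ ∈ T, M.val x θ = 1) → M.val x φ = 1

/-! ### Deductive calculi -/

/-- Axioms of Gödel-Dummett propositional calculus: Heyting calculus plus prelinearity. -/
inductive AxGodel {Var : Type u} : Formula Var → Prop
  | k (φ ψ : Formula Var) : AxGodel (imp φ (imp ψ φ))
  | s (φ ψ χ : Formula Var) :
      AxGodel (imp (imp φ (imp ψ χ)) (imp (imp φ ψ) (imp φ χ)))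
  | andLeft (φ ψ : Formula Var) : AxGodel (imp (and φ ψ) φ)
  | andRight (φ ψ : Formula Var) : AxGodel (imp (and φ ψ) ψ)
  | andIntro (φ ψ : Formula Var) : AxGodel (imp φ (imp ψ (and φ ψ)))
  | orLeft (φ ψ : Formula Var) : AxGodel (imp φ (or φ ψ))
  | orRight (φ ψ : Formula Var) : AxGodel (imp ψ (or φ ψ))
  | orElim (φ ψ χ : Formula Var) :
      AxGodel (imp (imp φ χ) (imp (imp ψ χ) (imp (or φ ψ) χ)))
  | exFalso (φ : Formula Var) : AxGodel (imp bot φ)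
  | prelin (φ ψ : Formula Var) : AxGodel (or (imp φ ψ) (imp ψ φ))

/-- Axioms of the basic bi-modal Gödel logic. -/
inductive AxG {Var : Type u} : Formula Var → Prop
  | godel {φ : Formula Var} : AxGodel φ → AxG φ
  | kBox (φ ψ : Formula Var) : AxG (imp (box (imp φ ψ)) (imp (box φ) (box ψ)))
  | kDia (φ ψ : Formula Var) : AxG (imp (dia (or φ ψ)) (or (dia φ) (dia ψ)))
  | fDia : AxG (neg (dia bot))
  | fs1 (φ ψ : Formula Var) : AxG (imp (dia (imp φ ψ)) (imp (box φ) (dia ψ)))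
  | fs2 (φ ψ : Formula Var) : AxG (imp (imp (dia φ) (box ψ)) (box (imp φ ψ)))

/-- Axioms of the Gödel analogue of bi-modal `T`. -/
inductive AxGT {Var : Type u} : Formula Var → Prop
  | base {φ : Formula Var} : AxG φ → AxGT φ
  | tBox (φ : Formula Var) : AxGT (imp (box φ) φ)
  | tDia (φ : Formula Var) : AxGT (imp φ (dia φ))

/-- Axioms of the Gödel analogue of bi-modal `S4`. -/
inductive AxGS4 {Var : Type u} : Formula Var → Prop
  | base {φ : Formula Var} : AxGT φ → AxGS4 φ
  | fourBox (φ : Formula Var) : AxGS4 (imp (box φ) (box (box φ)))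
  | fourDia (φ : Formula Var) : AxGS4 (imp (dia (dia φ)) (dia φ))

/-- Axioms of the Gödel analogue of bi-modal `S5`. -/
inductive AxGS5 {Var : Type u} : Formula Var → Prop
  | base {φ : Formula Var} : AxGS4 φ → AxGS5 φ
  | m1 (φ : Formula Var) : AxGS5 (imp φ (box (dia φ)))
  | m2 (φ : Formula Var) : AxGS5 (imp (dia (box φ)) φ)

/-- Deduction from assumptions in the calculus with axioms `Ax`, modus ponens, and the two modal
rules. The modal rules apply only to theorems, that is, to formulas deduced from no assumption. -/
inductive Deriv {Var : Type u} (Ax : Formula Var → Prop) :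
    Set (Formula Var) → Formula Var → Prop
  | ax {T : Set (Formula Var)} {φ : Formula Var} : Ax φ → Deriv Ax T φ
  | hyp {T : Set (Formula Var)} {φ : Formula Var} : φ ∈ T → Deriv Ax T φ
  | mp {T : Set (Formula Var)} {φ ψ : Formula Var} :
      Deriv Ax T (imp φ ψ) → Deriv Ax T φ → Deriv Ax T ψ
  | necBox {T : Set (Formula Var)} {φ : Formula Var} : Deriv Ax ∅ φ → Deriv Ax T (box φ)
  | monoDia {T : Set (Formula Var)} {φ ψ : Formula Var} :
      Deriv Ax ∅ (imp φ ψ) → Deriv Ax T (imp (dia φ) (dia ψ))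

end BiModal

/-! Soundness is a computation in the Heyting algebra `[0,1]`. For completeness the worlds are Gödel
valuations of all formulas, with modal formulas treated as atoms and theorems sent to `1`. The
degree S(x,y) is the largest `s` with min(s, x(□θ)) ≤ y(θ) and min(s, y(θ)) ≤ x(◇θ) for all θ. The
T, S4 and S5 axioms, read at each world, then make S reflexive, transitive and symmetric, so the
work is in the truth lemma.

That lemma needs a world y for each □φ and ◇φ whose value at x calls for one. A prime theory gives a
countable Lindenbaum chain, which must be mapped to truth values within the bounds set by x. `[0,1]`
has too little room for the strict inequalities involved, so valuations first live in a countably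
saturated order, an ultrapower of ℚ. There the embedding exists
(`CountablySaturated.exists_strictMono`, `IsVal.exists_rel`). The Fischer Servi axioms `fs1` and
`fs2` are what make the bounds compatible. Diamonds get exact witnesses, boxes get arbitrarily close
ones.

A countable family of valuations and values closed under witnesses is built by iteration
(`Stage.exists_extends_self`). Its values form a countable dense unbounded order, so Cantor's
theorem carries the part between 0 and 1 onto a dense subset of `[0,1]`. Density turns approximate
box witnesses into genuine infima.

The construction needs countably many formulas. A countable T and φ use countably many variables, so
everything is renamed into `Formula ℕ` and substituted back. -/

namespace BiModal

open Formula Set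

/-! ### Countable saturation of linear orders -/

/-- Any two countable sets, one below the other, can be separated by a point. -/
def CountablySaturated (K : Type*) [LinearOrder K] : Prop :=
  ∀ A B : Set K, A.Countable → B.Countable → (∀ a ∈ A, ∀ b ∈ B, a < b) →
    ∃ c, (∀ a ∈ A, a < c) ∧ ∀ b ∈ B, c < b

/-- The ultrapower of `ℚ` along a non-principal ultrafilter on `ℕ`. -/
abbrev HyperRat : Type := Filter.Germ (Filter.hyperfilter ℕ : Filter ℕ) ℚ

/-- Diagonal argument: coordinate `i` of the separating element only has to separate the first few
pairs. Each fixed pair is handled at almost all coordinates. -/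
theorem HyperRat.exists_between_seq (a b : ℕ → HyperRat) (h : ∀ m n, a m < b n) :
    ∃ c, ∀ n, a n < c ∧ c < b n := by
  choose a' ha using fun n => Quotient.exists_rep (a n)
  choose b' hb using fun n => Quotient.exists_rep (b n)
  have key : ∀ i, ∃ q : ℚ, ∀ n ≤ i, (∀ k ≤ n, ∀ l ≤ n, a' k i < b' l i) →
      a' n i < q ∧ q < b' n i := by
    intro i
    -- The defining condition passes to smaller indices, so any two members are compared through the
    -- larger one. This makes the finite sets at coordinate `i` separable in ℚ.
    let N : Finset ℕ := (Finset.range (i + 1)).filter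
      fun n => ∀ k ≤ n, ∀ l ≤ n, a' k i < b' l i
    have h1 : ∀ x ∈ N.image (fun n => a' n i), ∀ y ∈ N.image (fun n => b' n i), x < y := by
      intro x hx y hy
      obtain ⟨m, hm, rfl⟩ := Finset.mem_image.1 hx
      obtain ⟨n, hn, rfl⟩ := Finset.mem_image.1 hy
      rcases le_total m n with hmn | hmn
      · exact (Finset.mem_filter.1 hn).2 m hmn n le_rfl
      · exact (Finset.mem_filter.1 hm).2 m le_rfl n hmn
    obtain ⟨q, hq1, hq2⟩ := Order.exists_between_finsets _ _ h1
    refine ⟨q, fun n hn hn' => ?_⟩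
    have hN : n ∈ N := Finset.mem_filter.2 ⟨Finset.mem_range.2 (by omega), hn'⟩
    exact ⟨hq1 _ (Finset.mem_image_of_mem _ hN), hq2 _ (Finset.mem_image_of_mem _ hN)⟩
  choose q hq using key
  refine ⟨(q : HyperRat), fun n => ?_⟩
  have hge : ∀ᶠ i in (Filter.hyperfilter ℕ : Filter ℕ), n ≤ i :=
    Nat.hyperfilter_le_atTop (Filter.eventually_ge_atTop n)
  have hlt : ∀ᶠ i in (Filter.hyperfilter ℕ : Filter ℕ), ∀ k ≤ n, ∀ l ≤ n, a' k i < b' l i := by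
    have : ∀ k l, ∀ᶠ i in (Filter.hyperfilter ℕ : Filter ℕ), a' k i < b' l i := by
      intro k l
      have := h k l
      rw [← ha, ← hb] at this
      exact Filter.Germ.coe_lt.1 this
    have h2 : ∀ k ∈ Finset.range (n + 1), ∀ᶠ i in (Filter.hyperfilter ℕ : Filter ℕ),
        ∀ l ∈ Finset.range (n + 1), a' k i < b' l i := fun k _ =>
      (Filter.eventually_all_finset _).2 fun l _ => this k l
    filter_upwards [(Filter.eventually_all_finset _).2 h2] with i hi k hk l hl
    exact hi k (Finset.mem_range.2 (by omega)) l (Finset.mem_range.2 (by omega))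
  rw [← ha n, ← hb n]
  constructor
  · refine Filter.Germ.coe_lt.2 ?_
    filter_upwards [hge, hlt] with i hi hi'
    exact (hq i n hi hi').1
  · refine Filter.Germ.coe_lt.2 ?_
    filter_upwards [hge, hlt] with i hi hi'
    exact (hq i n hi hi').2

theorem HyperRat.countablySaturated : CountablySaturated HyperRat := by
  intro A B hA hB h
  -- Adjoining `a0` and `b0` makes both sets nonempty, hence ranges of sequences.
  obtain ⟨a0, b0, h00, h0B, hA0⟩ : ∃ a0 b0 : HyperRat, a0 < b0 ∧ (∀ b ∈ B, a0 < b) ∧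
      ∀ a ∈ A, a < b0 := by
    have lower : ∀ B : Set HyperRat, B.Countable → ∃ a0, ∀ b ∈ B, a0 < b := by
      intro B hB
      rcases B.eq_empty_or_nonempty with rfl | hne
      · exact ⟨0, by simp⟩
      obtain ⟨f, hf⟩ := hB.exists_eq_range hne
      choose f' hf' using fun n => Quotient.exists_rep (f n)
      have key : ∀ i, ∃ q : ℚ, ∀ n ≤ i, q < f' n i := by
        intro i
        obtain ⟨q, hq⟩ := ((Finset.range (i + 1)).image (fun n => f' n i)).bddBelow
        refine ⟨q - 1, fun n hn => ?_⟩
        have : q ≤ f' n i := hq (Finset.mem_coe.2 (Finset.mem_image_of_mem _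
          (Finset.mem_range.2 (by omega))))
        linarith
      choose q hq using key
      refine ⟨(q : HyperRat), ?_⟩
      rw [hf]
      rintro _ ⟨n, rfl⟩
      rw [← hf']
      refine Filter.Germ.coe_lt.2 ?_
      filter_upwards [Nat.hyperfilter_le_atTop (Filter.eventually_ge_atTop n)] with i hi
      exact hq i n hi
    have upper : ∃ b0, ∀ a ∈ A, a < b0 := by
      obtain ⟨c, hc⟩ := lower ((fun x => -x) '' A) (hA.image _)
      exact ⟨-c, fun a ha => lt_neg.1 (hc _ (mem_image_of_mem _ ha))⟩
    obtain ⟨a0, ha0⟩ := lower B hB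
    obtain ⟨b0, hb0⟩ := upper
    by_cases hA' : A.Nonempty
    · obtain ⟨a, ha⟩ := hA'
      refine ⟨min a0 a, b0, (min_le_right _ _).trans_lt (hb0 a ha), fun b hb =>
        (min_le_left _ _).trans_lt (ha0 b hb), hb0⟩
    · rw [not_nonempty_iff_eq_empty] at hA'
      subst hA'
      exact ⟨a0, a0 + 1, by simp, ha0, by simp⟩
  obtain ⟨a, ha⟩ := (hA.insert a0).exists_eq_range (insert_nonempty _ _)
  obtain ⟨b, hb⟩ := (hB.insert b0).exists_eq_range (insert_nonempty _ _)
  have hab : ∀ x ∈ insert a0 A, ∀ y ∈ insert b0 B, x < y := by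
    rintro x (rfl | hx) y (rfl | hy)
    exacts [h00, h0B y hy, hA0 x hx, h x hx y hy]
  obtain ⟨c, hc⟩ := HyperRat.exists_between_seq a b fun m n =>
    hab _ (ha ▸ mem_range_self m) _ (hb ▸ mem_range_self n)
  refine ⟨c, fun x hx => ?_, fun y hy => ?_⟩
  · obtain ⟨n, rfl⟩ : x ∈ range a := ha ▸ mem_insert_of_mem _ hx
    exact (hc n).1
  · obtain ⟨n, rfl⟩ : y ∈ range b := hb ▸ mem_insert_of_mem _ hy
    exact (hc n).2

/-- A countable linear order embeds in a countably saturated one, subject to countably many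
compatible bounds. -/
theorem CountablySaturated.exists_strictMono {K D : Type*} [LinearOrder K] [Nonempty K]
    (hK : CountablySaturated K) [LinearOrder D] [Countable D] (L U : D → Set K)
    (hLc : ∀ d, (L d).Countable) (hUc : ∀ d, (U d).Countable)
    (hL : Monotone L) (hU : Antitone U) (hLU : ∀ d, ∀ l ∈ L d, ∀ r ∈ U d, l ≤ r)
    (hlt : ∀ d d', d < d' → Disjoint (L d) (U d')) :
    ∃ e : D → K, StrictMono e ∧ ∀ d, (∀ l ∈ L d, l ≤ e d) ∧ ∀ r ∈ U d, e d ≤ r := by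
  classical
  obtain ⟨enc, henc⟩ := exists_injective_nat D
  -- `G d prev k` says that `k` is a legal value at `d` given the earlier ones. The clause `k ∈ L d
  -- ↔ k ∈ U d` lets `k` equal a bound only when it is forced as both a lower and an upper bound,
  -- which keeps later choices strict.
  let G : (d : D) → ((d' : D) → enc d' < enc d → K) → K → Prop := fun d prev k =>
    (∀ l ∈ L d, l ≤ k) ∧ (∀ r ∈ U d, k ≤ r) ∧ (k ∈ L d ↔ k ∈ U d) ∧
      ∀ d' h, (d' < d → prev d' h < k) ∧ (d < d' → k < prev d' h)
  -- The arbitrary default never occurs: `good` shows that a legal value always exists.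
  let F : (d : D) → ((d' : D) → enc d' < enc d → K) → K := fun d prev =>
    if h : ∃ k, G d prev k then h.choose else Classical.arbitrary K
  let e : D → K := (measure enc).wf.fix F
  have he : ∀ d, e d = F d (fun d' _ => e d') := fun d => (measure enc).wf.fix_eq F d
  have good : ∀ d, G d (fun d' _ => e d') (e d) := by
    intro d
    induction d using (measure enc).wf.induction with
    | _ d ih =>
    have ih : ∀ d', enc d' < enc d → G d' (fun d'' _ => e d'') (e d') := ih
    suffices h : ∃ k, G d (fun d' _ => e d') k by
      rw [he d]
      simp only [F, dif_pos h]
      exact h.choose_spec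
    -- A common bound determines the value. Otherwise all constraints from below lie strictly under
    -- those from above, and saturation supplies a point.
    by_cases hc : ∃ c, c ∈ L d ∧ c ∈ U d
    · obtain ⟨c, hcL, hcU⟩ := hc
      refine ⟨c, fun l hl => hLU d l hl c hcU, fun r hr => hLU d c hcL r hr, by simp [hcL, hcU],
        fun d' hd' => ⟨fun hlt' => ?_, fun hlt' => ?_⟩⟩
      · obtain ⟨-, h2, h3, -⟩ := ih d' hd'
        have hcU' := hU hlt'.le hcU
        refine lt_of_le_of_ne (h2 c hcU') fun heq : e d' = c => ?_
        exact disjoint_left.1 (hlt d' d hlt') (heq ▸ h3.2 (heq.symm ▸ hcU')) hcU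
      · obtain ⟨h1, -, h3, -⟩ := ih d' hd'
        have hcL' := hL hlt'.le hcL
        refine lt_of_le_of_ne (h1 c hcL') fun heq : c = e d' => ?_
        exact disjoint_left.1 (hlt d d' hlt') hcL (heq.symm ▸ h3.1 (heq ▸ hcL'))
    · push Not at hc
      obtain ⟨k, hk1, hk2⟩ := hK (L d ∪ e '' {d' | d' < d ∧ enc d' < enc d})
        (U d ∪ e '' {d' | d < d' ∧ enc d' < enc d})
        ((hLc d).union ((to_countable _).image e)) ((hUc d).union ((to_countable _).image e)) (by
          rintro a (ha | ⟨x, ⟨hx, hx'⟩, rfl⟩) b (hb | ⟨y, ⟨hy, hy'⟩, rfl⟩)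
          · exact lt_of_le_of_ne (hLU d a ha b hb) fun h => hc a ha (h ▸ hb)
          · obtain ⟨h1, -, h3, -⟩ := ih y hy'
            have := hL hy.le ha
            refine lt_of_le_of_ne (h1 a this) fun heq => ?_
            exact disjoint_left.1 (hlt d y hy) ha (heq.symm ▸ h3.1 (heq ▸ this))
          · obtain ⟨-, h2, h3, -⟩ := ih x hx'
            have := hU hx.le hb
            refine lt_of_le_of_ne (h2 b this) fun heq => ?_
            exact disjoint_left.1 (hlt x d hx) (heq ▸ h3.2 (heq.symm ▸ this)) hb
          · have hxy := hx.trans hy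
            rcases lt_trichotomy (enc x) (enc y) with h | h | h
            · exact ((ih y hy').2.2.2 x h).1 hxy
            · exact absurd (henc h) hxy.ne
            · exact ((ih x hx').2.2.2 y h).2 hxy)
      refine ⟨k, fun l hl => (hk1 l (Or.inl hl)).le, fun r hr => (hk2 r (Or.inl hr)).le,
        ⟨fun h => absurd (hk1 k (Or.inl h)) (lt_irrefl _),
          fun h => absurd (hk2 k (Or.inl h)) (lt_irrefl _)⟩, fun d' hd' => ⟨fun h => ?_, fun h => ?_⟩⟩
      · exact hk1 _ (Or.inr ⟨d', ⟨h, hd'⟩, rfl⟩)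
      · exact hk2 _ (Or.inr ⟨d', ⟨h, hd'⟩, rfl⟩)
  refine ⟨e, fun x y hxy => ?_, fun d => ⟨(good d).1, (good d).2.1⟩⟩
  rcases lt_trichotomy (enc x) (enc y) with h | h | h
  · exact ((good y).2.2.2 x h).1 hxy
  · exact absurd (henc h) hxy.ne
  · exact ((good x).2.2.2 y h).2 hxy

/-- A countable dense unbounded subset of a linear order can be mapped to a dense subset of the
unit interval, any two of its points going to the endpoints. -/
theorem exists_dense_map_unitInterval {K : Type*} [LinearOrder K] {C : Set K} (hC : C.Countable)
    (hd : ∀ a ∈ C, ∀ b ∈ C, a < b → ∃ c ∈ C, a < c ∧ c < b)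
    (hmin : ∀ a ∈ C, ∃ c ∈ C, c < a) (hmax : ∀ a ∈ C, ∃ c ∈ C, a < c)
    {o i : K} (ho : o ∈ C) (hi : i ∈ C) (hoi : o < i) :
    ∃ g : K → unitInterval, g o = 0 ∧ g i = 1 ∧ StrictMonoOn g (C ∩ Icc o i) ∧
      ∀ a b : unitInterval, a < b → ∃ c ∈ C ∩ Icc o i, a < g c ∧ g c < b := by
  classical
  have : Countable C := hC.to_subtype
  have : DenselyOrdered C := ⟨fun a b hab => by
    obtain ⟨c, hc, h1, h2⟩ := hd a a.2 b b.2 hab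
    exact ⟨⟨c, hc⟩, h1, h2⟩⟩
  have : NoMinOrder C := ⟨fun a => by
    obtain ⟨c, hc, h⟩ := hmin a a.2
    exact ⟨⟨c, hc⟩, h⟩⟩
  have : NoMaxOrder C := ⟨fun a => by
    obtain ⟨c, hc, h⟩ := hmax a a.2
    exact ⟨⟨c, hc⟩, h⟩⟩
  have : Nonempty C := ⟨⟨o, ho⟩⟩
  obtain ⟨f⟩ := Order.iso_of_countable_dense C ℚ
  let p : ℝ := f ⟨o, ho⟩
  let q : ℝ := f ⟨i, hi⟩
  have hpq : 0 < q - p := sub_pos.2 (Rat.cast_lt.2 (f.lt_iff_lt.2 hoi))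
  let h : C → ℝ := fun c => ((f c : ℝ) - p) / (q - p)
  have hmono : StrictMono h := fun a b hab =>
    div_lt_div_of_pos_right (sub_lt_sub_right (Rat.cast_lt.2 (f.lt_iff_lt.2 hab)) _) hpq
  have h0 : h ⟨o, ho⟩ = 0 := by simp [h, p]
  have h1 : h ⟨i, hi⟩ = 1 := by
    simp only [h]
    exact div_self hpq.ne'
  -- Only the behaviour on `C ∩ Icc o i` matters; other points of `C` are clamped and points outside
  -- `C` go to 0.
  let g : K → unitInterval := fun k =>
    if hk : k ∈ C then projIcc 0 1 zero_le_one (h ⟨k, hk⟩) else 0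
  have hmem : ∀ k (hk : k ∈ C), k ∈ Icc o i → h ⟨k, hk⟩ ∈ Icc (0 : ℝ) 1 := fun k hk hk' =>
    ⟨h0 ▸ hmono.monotone (a := ⟨o, ho⟩) (b := ⟨k, hk⟩) hk'.1,
      h1 ▸ hmono.monotone (a := ⟨k, hk⟩) (b := ⟨i, hi⟩) hk'.2⟩
  have hg : ∀ k (hk : k ∈ C), k ∈ Icc o i → (g k : ℝ) = h ⟨k, hk⟩ := fun k hk hk' => by
    simp only [g, dif_pos hk]
    rw [projIcc_of_mem _ (hmem k hk hk')]
  refine ⟨g, Subtype.ext ?_, Subtype.ext ?_, ?_, ?_⟩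
  · rw [hg o ho ⟨le_rfl, hoi.le⟩, h0]; rfl
  · rw [hg i hi ⟨hoi.le, le_rfl⟩, h1]; rfl
  · intro a ha b hb hab
    rw [← Subtype.coe_lt_coe, hg a ha.1 ha.2, hg b hb.1 hb.2]
    exact hmono hab
  · intro a b hab
    have hab' : (a : ℝ) * (q - p) + p < (b : ℝ) * (q - p) + p := by
      have : (a : ℝ) < b := hab
      nlinarith
    obtain ⟨r, hr1, hr2⟩ := exists_rat_btwn hab'
    let c := f.symm r
    have hc : h c = ((r : ℝ) - p) / (q - p) := by simp [h, c]
    have hac : (a : ℝ) < h c := by rw [hc, lt_div_iff₀ hpq]; linarith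
    have hcb : h c < b := by rw [hc, div_lt_iff₀ hpq]; linarith
    have hcI : (c : K) ∈ Icc o i := by
      constructor
      · have : h ⟨o, ho⟩ ≤ h c := by rw [h0]; exact a.2.1.trans hac.le
        exact hmono.le_iff_le.1 this
      · have : h c ≤ h ⟨i, hi⟩ := by rw [h1]; exact hcb.le.trans b.2.2
        exact hmono.le_iff_le.1 this
    refine ⟨c, ⟨c.2, hcI⟩, ?_, ?_⟩
    · rw [← Subtype.coe_lt_coe, hg c c.2 hcI]; exact hac
    · rw [← Subtype.coe_lt_coe, hg c c.2 hcI]; exact hcb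

/-! ### Soundness -/

section Soundness

variable {Var : Type u}

theorem GKModel.val_imp_eq_one (M : GKModel.{u, v} Var) (x : M.World) (φ ψ : Formula Var) :
    M.val x (imp φ ψ) = 1 ↔ M.val x φ ≤ M.val x ψ := by
  simp only [GKModel.val]
  exact himp_eq_top_iff

theorem AxGodel.sound {φ : Formula Var} (h : AxGodel φ) (M : GKModel.{u, v} Var) (x : M.World) :
    M.val x φ = 1 := by
  cases h with
  | k φ ψ => rw [M.val_imp_eq_one]; exact le_himp
  | s φ ψ χ =>
    rw [M.val_imp_eq_one]
    simp only [GKModel.val]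
    rw [le_himp_iff, le_himp_iff]
    generalize M.val x φ = a
    generalize M.val x ψ = b
    generalize M.val x χ = c
    have h1 : (a ⇨ b ⇨ c) ⊓ (a ⇨ b) ⊓ a ≤ b :=
      (le_inf (inf_le_left.trans inf_le_right) inf_le_right).trans himp_inf_le
    have h2 : (a ⇨ b ⇨ c) ⊓ (a ⇨ b) ⊓ a ≤ b ⇨ c :=
      (le_inf (inf_le_left.trans inf_le_left) inf_le_right).trans himp_inf_le
    exact (le_inf h2 h1).trans himp_inf_le
  | andLeft φ ψ => rw [M.val_imp_eq_one]; exact inf_le_left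
  | andRight φ ψ => rw [M.val_imp_eq_one]; exact inf_le_right
  | andIntro φ ψ =>
    rw [M.val_imp_eq_one]
    exact le_himp_iff.2 le_rfl
  | orLeft φ ψ => rw [M.val_imp_eq_one]; exact le_sup_left
  | orRight φ ψ => rw [M.val_imp_eq_one]; exact le_sup_right
  | orElim φ ψ χ =>
    rw [M.val_imp_eq_one]
    simp only [GKModel.val]
    rw [le_himp_iff, sup_himp_distrib]
  | exFalso φ => rw [M.val_imp_eq_one]; exact bot_le
  | prelin φ ψ =>
    rcases le_total (M.val x φ) (M.val x ψ) with h | h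
    · exact top_le_iff.1 (((M.val_imp_eq_one x _ _).2 h).ge.trans le_sup_left)
    · exact top_le_iff.1 (((M.val_imp_eq_one x _ _).2 h).ge.trans le_sup_right)

theorem AxG.sound {φ : Formula Var} (h : AxG φ) (M : GKModel.{u, v} Var) (x : M.World) :
    M.val x φ = 1 := by
  cases h with
  | godel h => exact h.sound M x
  | kBox φ ψ =>
    rw [M.val_imp_eq_one]
    simp only [GKModel.val]
    rw [le_himp_iff]
    refine le_iInf fun y => ?_
    rw [le_himp_iff]
    have h1 : ((⨅ y, M.S x y ⇨ M.val y φ ⇨ M.val y ψ) ⊓ ⨅ y, M.S x y ⇨ M.val y φ) ⊓ M.S x y ≤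
        M.val y φ ⇨ M.val y ψ :=
      (inf_le_inf_right _ (inf_le_left.trans (iInf_le _ y))).trans himp_inf_le
    have h2 : ((⨅ y, M.S x y ⇨ M.val y φ ⇨ M.val y ψ) ⊓ ⨅ y, M.S x y ⇨ M.val y φ) ⊓ M.S x y ≤
        M.val y φ :=
      (inf_le_inf_right _ (inf_le_right.trans (iInf_le _ y))).trans himp_inf_le
    exact (le_inf h1 h2).trans himp_inf_le
  | kDia φ ψ =>
    rw [M.val_imp_eq_one]
    simp only [GKModel.val]
    refine iSup_le fun y => ?_
    rw [inf_sup_left]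
    exact sup_le_sup (le_iSup (fun y => M.S x y ⊓ M.val y φ) y)
      (le_iSup (fun y => M.S x y ⊓ M.val y ψ) y)
  | fDia =>
    rw [neg, M.val_imp_eq_one]
    simp only [GKModel.val]
    exact iSup_le fun y => inf_le_right
  | fs1 φ ψ =>
    rw [M.val_imp_eq_one]
    simp only [GKModel.val]
    refine iSup_le fun y => ?_
    rw [le_himp_iff]
    refine le_trans ?_ (le_iSup (fun y => M.S x y ⊓ M.val y ψ) y)
    have h1 : M.S x y ⊓ (M.val y φ ⇨ M.val y ψ) ⊓ (⨅ y, M.S x y ⇨ M.val y φ) ≤ M.val y φ :=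
      (le_inf (inf_le_right.trans (iInf_le _ y)) (inf_le_left.trans inf_le_left)).trans himp_inf_le
    exact le_inf (inf_le_left.trans inf_le_left)
      ((le_inf (inf_le_left.trans inf_le_right) h1).trans himp_inf_le)
  | fs2 φ ψ =>
    rw [M.val_imp_eq_one]
    simp only [GKModel.val]
    refine le_iInf fun y => ?_
    rw [le_himp_iff, le_himp_iff]
    have h1 : ((⨆ y, M.S x y ⊓ M.val y φ) ⇨ ⨅ y, M.S x y ⇨ M.val y ψ) ⊓ M.S x y ⊓ M.val y φ ≤
        ⨅ y, M.S x y ⇨ M.val y ψ := by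
      rw [inf_assoc]
      exact (inf_le_inf_left _ (le_iSup (fun y => M.S x y ⊓ M.val y φ) y)).trans himp_inf_le
    exact (le_inf (h1.trans (iInf_le _ y)) (inf_le_left.trans inf_le_right)).trans himp_inf_le

theorem AxGT.sound {φ : Formula Var} (h : AxGT φ) {M : GKModel.{u, v} Var}
    (hM : M ∈ Ref.{u, v} Var) (x : M.World) : M.val x φ = 1 := by
  have hS : M.S x x = ⊤ := hM x
  cases h with
  | base h => exact h.sound M x
  | tBox φ =>
    rw [M.val_imp_eq_one]
    simp only [GKModel.val]
    refine (iInf_le _ x).trans ?_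
    rw [hS, top_himp]
  | tDia φ =>
    rw [M.val_imp_eq_one]
    simp only [GKModel.val]
    refine le_trans ?_ (le_iSup _ x)
    rw [hS, top_inf_eq]

theorem AxGS4.sound {φ : Formula Var} (h : AxGS4 φ) {M : GKModel.{u, v} Var}
    (hM : M ∈ Ref.{u, v} Var ∩ Trans.{u, v} Var) (x : M.World) : M.val x φ = 1 := by
  cases h with
  | base h => exact h.sound hM.1 x
  | fourBox φ =>
    rw [M.val_imp_eq_one]
    simp only [GKModel.val]
    refine le_iInf fun y => ?_
    rw [le_himp_iff]
    refine le_iInf fun z => ?_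
    rw [le_himp_iff, inf_assoc, ← le_himp_iff]
    exact (iInf_le _ z).trans (himp_le_himp_right (hM.2 x y z))
  | fourDia φ =>
    rw [M.val_imp_eq_one]
    simp only [GKModel.val]
    refine iSup_le fun y => ?_
    rw [inf_iSup_eq]
    refine iSup_le fun z => ?_
    rw [← inf_assoc]
    exact (inf_le_inf_right _ (hM.2 x y z)).trans (le_iSup (fun z => M.S x z ⊓ M.val z φ) z)

theorem AxGS5.sound {φ : Formula Var} (h : AxGS5 φ) {M : GKModel.{u, v} Var}
    (hM : M ∈ Ref.{u, v} Var ∩ Trans.{u, v} Var ∩ Symm.{u, v} Var) (x : M.World) :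
    M.val x φ = 1 := by
  cases h with
  | base h => exact h.sound hM.1 x
  | m1 φ =>
    rw [M.val_imp_eq_one]
    simp only [GKModel.val]
    refine le_iInf fun y => ?_
    rw [le_himp_iff, inf_comm, hM.2 x y]
    exact le_iSup (fun z => M.S y z ⊓ M.val z φ) x
  | m2 φ =>
    rw [M.val_imp_eq_one]
    simp only [GKModel.val]
    refine iSup_le fun y => ?_
    rw [inf_comm, ← le_himp_iff, hM.2 x y]
    exact iInf_le _ x

theorem Deriv.sound {Ax : Formula Var → Prop} {T : Set (Formula Var)} {φ : Formula Var}
    (h : Deriv Ax T φ) {M : GKModel.{u, v} Var} (hM : ∀ φ, Ax φ → ∀ x, M.val x φ = 1)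
    (x : M.World) (hx : ∀ θ ∈ T, M.val x θ = 1) : M.val x φ = 1 := by
  -- The modal rules need their premise at every world; this is available because the premise has no
  -- assumptions.
  induction h generalizing x with
  | ax h => exact hM _ h x
  | hyp h => exact hx _ h
  | mp _ _ ih1 ih2 =>
    have h1 := (M.val_imp_eq_one x _ _).1 (ih1 x hx)
    rw [ih2 x hx] at h1
    exact top_le_iff.1 h1
  | necBox _ ih =>
    simp only [GKModel.val]
    exact iInf_eq_top.2 fun y => himp_eq_top_iff.2 (le_top.trans (ih y (by simp)).ge)
  | monoDia _ ih =>
    rw [M.val_imp_eq_one]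
    simp only [GKModel.val]
    exact iSup_mono fun y => inf_le_inf_left _ ((M.val_imp_eq_one y _ _).1 (ih y (by simp)))

end Soundness

/-! ### Renaming and substitution of variables -/

namespace Formula

variable {V V' : Type*}

/-- Substitution of formulas for variables. -/
def subst (σ : V → Formula V') : Formula V → Formula V'
  | .var p => σ p
  | .bot => .bot
  | .and φ ψ => .and (φ.subst σ) (ψ.subst σ)
  | .or φ ψ => .or (φ.subst σ) (ψ.subst σ)
  | .imp φ ψ => .imp (φ.subst σ) (ψ.subst σ)
  | .box φ => .box (φ.subst σ)
  | .dia φ => .dia (φ.subst σ)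

/-- The variables of a formula. -/
def vars : Formula V → Set V
  | .var p => {p}
  | .bot => ∅
  | .and φ ψ => φ.vars ∪ ψ.vars
  | .or φ ψ => φ.vars ∪ ψ.vars
  | .imp φ ψ => φ.vars ∪ ψ.vars
  | .box φ => φ.vars
  | .dia φ => φ.vars

theorem vars_countable (φ : Formula V) : φ.vars.Countable := by
  induction φ with
  | var p => exact countable_singleton p
  | bot => exact countable_empty
  | and _ _ h1 h2 => exact h1.union h2
  | or _ _ h1 h2 => exact h1.union h2
  | imp _ _ h1 h2 => exact h1.union h2
  | box _ h => exact h
  | dia _ h => exact h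

theorem subst_subst_of_vars {σ : V → Formula V'} {τ : V' → Formula V} {φ : Formula V}
    (h : ∀ p ∈ φ.vars, (σ p).subst τ = var p) : (φ.subst σ).subst τ = φ := by
  induction φ with
  | var p => exact h p rfl
  | bot => rfl
  | and _ _ h1 h2 | or _ _ h1 h2 | imp _ _ h1 h2 =>
    simp only [subst, h1 fun p hp => h p (Or.inl hp), h2 fun p hp => h p (Or.inr hp)]
  | box _ h1 | dia _ h1 => simp only [subst, h1 h]

/-- A numbering of the formulas in countably many variables. -/
def code : Formula ℕ → ℕ
  | .var p => Nat.pair 0 p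
  | .bot => Nat.pair 1 0
  | .and φ ψ => Nat.pair 2 (Nat.pair φ.code ψ.code)
  | .or φ ψ => Nat.pair 3 (Nat.pair φ.code ψ.code)
  | .imp φ ψ => Nat.pair 4 (Nat.pair φ.code ψ.code)
  | .box φ => Nat.pair 5 φ.code
  | .dia φ => Nat.pair 6 φ.code

theorem code_injective : Function.Injective code := by
  intro φ
  induction φ with
  | var p => intro ψ h; cases ψ <;> simp_all [code, Nat.pair_eq_pair]
  | bot => intro ψ h; cases ψ <;> simp_all [code, Nat.pair_eq_pair]
  | and _ _ h1 h2 | or _ _ h1 h2 | imp _ _ h1 h2 =>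
    intro ψ h
    cases ψ <;> simp only [code, Nat.pair_eq_pair] at h <;> try omega
    rw [h1 h.2.1, h2 h.2.2]
  | box _ h1 | dia _ h1 =>
    intro ψ h
    cases ψ <;> simp only [code, Nat.pair_eq_pair] at h <;> try omega
    rw [h1 h.2]

instance : Countable (Formula ℕ) := code_injective.countable

end Formula

theorem AxGodel.subst {V V' : Type*} (σ : V → Formula V') {φ : Formula V} (h : AxGodel φ) :
    AxGodel (φ.subst σ) := by
  cases h <;> constructor

theorem AxG.subst {V V' : Type*} (σ : V → Formula V') {φ : Formula V} (h : AxG φ) :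
    AxG (φ.subst σ) := by
  cases h with
  | godel h => exact .godel (h.subst σ)
  | kBox => exact .kBox _ _
  | kDia => exact .kDia _ _
  | fDia => exact .fDia
  | fs1 => exact .fs1 _ _
  | fs2 => exact .fs2 _ _

theorem AxGT.subst {V V' : Type*} (σ : V → Formula V') {φ : Formula V} (h : AxGT φ) :
    AxGT (φ.subst σ) := by
  cases h with
  | base h => exact .base (h.subst σ)
  | tBox => exact .tBox _
  | tDia => exact .tDia _

theorem AxGS4.subst {V V' : Type*} (σ : V → Formula V') {φ : Formula V} (h : AxGS4 φ) :
    AxGS4 (φ.subst σ) := by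
  cases h with
  | base h => exact .base (h.subst σ)
  | fourBox => exact .fourBox _
  | fourDia => exact .fourDia _

theorem AxGS5.subst {V V' : Type*} (σ : V → Formula V') {φ : Formula V} (h : AxGS5 φ) :
    AxGS5 (φ.subst σ) := by
  cases h with
  | base h => exact .base (h.subst σ)
  | m1 => exact .m1 _
  | m2 => exact .m2 _

theorem Deriv.subst {V V' : Type*} {Ax : Formula V → Prop} {Ax' : Formula V' → Prop}
    (σ : V → Formula V') (hAx : ∀ φ, Ax φ → Ax' (φ.subst σ)) {T : Set (Formula V)}
    {φ : Formula V} (h : Deriv Ax T φ) : Deriv Ax' (Formula.subst σ '' T) (φ.subst σ) := by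
  induction h with
  | ax h => exact .ax (hAx _ h)
  | hyp h => exact .hyp (mem_image_of_mem _ h)
  | mp _ _ h1 h2 => exact .mp h1 h2
  | necBox _ h => rw [image_empty] at h; exact .necBox h
  | monoDia _ h => rw [image_empty] at h; exact .monoDia h

/-- The model obtained from `M` by lifting the universe of its worlds and renaming variables. -/
def GKModel.rename {V V' : Type*} (f : V → V') (M : GKModel.{_, 0} V') : GKModel.{_, v} V where
  World := ULift.{v} M.World
  nonempty := M.nonempty.map ULift.up
  S x y := M.S x.down y.down
  e x p := M.e x.down (f p)

/-- Carries a countermodel over ℕ-indexed variables back to the original language and universe. -/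
theorem GKModel.val_rename {V V' : Type*} (f : V → V') (M : GKModel.{_, 0} V') (x : M.World)
    (φ : Formula V) :
    (M.rename.{v} f).val ⟨x⟩ φ = M.val x (φ.subst fun p => .var (f p)) := by
  induction φ generalizing x with
  | var p => rfl
  | bot => rfl
  | and _ _ h1 h2 | or _ _ h1 h2 | imp _ _ h1 h2 =>
    simp only [GKModel.val, Formula.subst]; rw [h1 x, h2 x]
  | box _ h =>
    simp only [GKModel.val, Formula.subst]
    exact Equiv.ulift.iInf_congr fun y => congrArg (M.S x y.down ⇨ ·) (h y.down).symm
  | dia _ h =>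
    simp only [GKModel.val, Formula.subst]
    exact Equiv.ulift.iSup_congr fun y => congrArg (M.S x y.down ⊓ ·) (h y.down).symm

/-! ### Theories -/

section Theories

variable {Var : Type u} {Ax : Formula Var → Prop}

theorem Deriv.weaken {T : Set (Formula Var)} {φ : Formula Var} (h : Deriv Ax ∅ φ) :
    Deriv Ax T φ := by
  generalize hT : (∅ : Set (Formula Var)) = T' at h
  induction h with
  | ax h => exact .ax h
  | hyp h => subst hT; exact absurd h (notMem_empty _)
  | mp _ _ h1 h2 => exact .mp (h1 hT) (h2 hT)
  | necBox h _ => exact .necBox h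
  | monoDia h _ => exact .monoDia h

/-- A set of formulas that contains the theorems and is closed under modus ponens. -/
structure IsTheory (Ax : Formula Var → Prop) (Q : Set (Formula Var)) : Prop where
  thm : ∀ {θ}, Deriv Ax ∅ θ → θ ∈ Q
  mp : ∀ {θ ψ}, imp θ ψ ∈ Q → θ ∈ Q → ψ ∈ Q

theorem isTheory_deriv (T : Set (Formula Var)) : IsTheory Ax {θ | Deriv Ax T θ} :=
  ⟨fun h => h.weaken, fun h1 h2 => .mp h1 h2⟩

/-- The calculus extends the basic bi-modal Gödel logic. -/
def ExtendsG (Ax : Formula Var → Prop) : Prop := ∀ θ, AxG θ → Ax θ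

namespace IsTheory

variable {Q : Set (Formula Var)} (hQ : IsTheory Ax Q) (hAx : ExtendsG Ax)
  {θ ψ χ φ : Formula Var}
include hQ hAx

theorem axGodel (h : AxGodel θ) : θ ∈ Q := hQ.thm (.ax (hAx _ (.godel h)))

theorem imp_intro (h : ψ ∈ Q) : imp θ ψ ∈ Q := hQ.mp (hQ.axGodel hAx (.k ψ θ)) h

theorem imp_mp (h1 : imp θ (imp ψ χ) ∈ Q) (h2 : imp θ ψ ∈ Q) : imp θ χ ∈ Q :=
  hQ.mp (hQ.mp (hQ.axGodel hAx (.s θ ψ χ)) h1) h2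

theorem imp_trans (h1 : imp θ ψ ∈ Q) (h2 : imp ψ χ ∈ Q) : imp θ χ ∈ Q :=
  hQ.imp_mp hAx (hQ.imp_intro hAx h2) h1

theorem imp_self (θ : Formula Var) : imp θ θ ∈ Q :=
  hQ.imp_mp hAx (hQ.axGodel hAx (.k θ (imp θ θ))) (hQ.axGodel hAx (.k θ θ))

theorem or_elim (h1 : imp θ χ ∈ Q) (h2 : imp ψ χ ∈ Q) (h : or θ ψ ∈ Q) : χ ∈ Q :=
  hQ.mp (hQ.mp (hQ.mp (hQ.axGodel hAx (.orElim θ ψ χ)) h1) h2) h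

/-- The deduction theorem. -/
theorem adjoin (θ : Formula Var) : IsTheory Ax {χ | imp θ χ ∈ Q} :=
  ⟨fun h => hQ.imp_intro hAx (hQ.thm h), fun h1 h2 => hQ.imp_mp hAx h1 h2⟩

end IsTheory

/-- A consistent theory with the disjunction property. -/
structure IsPrime (Ax : Formula Var → Prop) (Q : Set (Formula Var)) : Prop extends
    IsTheory Ax Q where
  or_mem : ∀ {θ ψ : Formula Var}, Formula.or θ ψ ∈ Q → θ ∈ Q ∨ ψ ∈ Q
  bot_notMem : bot ∉ Q

/-- A theory maximal among those disjoint from `I` is prime: each θ outside it implies, modulo the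
theory, some member of `I`, and directedness merges the members obtained from two disjuncts.
Allowing a set `I` rather than one formula is needed for diamonds. -/
theorem IsTheory.exists_isPrime (hAx : ExtendsG Ax) {Q₀ I : Set (Formula Var)}
    (h₀ : IsTheory Ax Q₀) (hI : I.Nonempty) (hd : Disjoint Q₀ I)
    (hdir : ∀ a ∈ I, ∀ b ∈ I, ∃ c ∈ I, Deriv Ax ∅ (imp a c) ∧ Deriv Ax ∅ (imp b c)) :
    ∃ Q, Q₀ ⊆ Q ∧ IsPrime Ax Q ∧ Disjoint Q I := by
  obtain ⟨Q, hQ₀, hmax⟩ := zorn_subset_nonempty {Q | IsTheory Ax Q ∧ Disjoint Q I}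
    (by
      intro c hc hchain hne
      refine ⟨⋃₀ c, ⟨⟨fun h => ?_, fun h1 h2 => ?_⟩, ?_⟩, fun s hs => subset_sUnion_of_mem hs⟩
      · obtain ⟨s, hs⟩ := hne
        exact ⟨s, hs, (hc hs).1.thm h⟩
      · obtain ⟨s, hs, h1⟩ := h1
        obtain ⟨t, ht, h2⟩ := h2
        rcases hchain.total hs ht with h | h
        · exact ⟨t, ht, (hc ht).1.mp (h h1) h2⟩
        · exact ⟨s, hs, (hc hs).1.mp h1 (h h2)⟩
      · exact disjoint_sUnion_left.2 fun s hs => (hc hs).2) Q₀ ⟨h₀, hd⟩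
  have hQ := hmax.prop.1
  have key : ∀ θ, θ ∉ Q → ∃ χ ∈ I, imp θ χ ∈ Q := by
    intro θ hθ
    by_contra! hcon
    refine hθ (hmax.le_of_ge (y := {χ | imp θ χ ∈ Q}) ⟨hQ.adjoin hAx θ, disjoint_left.2
      fun χ h1 h2 => hcon χ h2 h1⟩ (fun χ hχ => hQ.imp_intro hAx hχ) (hQ.imp_self hAx θ))
  refine ⟨Q, hQ₀, ⟨hQ, fun {θ ψ} h => ?_, fun h => ?_⟩, hmax.prop.2⟩
  · by_contra! hcon
    obtain ⟨a, ha, ha'⟩ := key θ hcon.1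
    obtain ⟨b, hb, hb'⟩ := key ψ hcon.2
    obtain ⟨c, hc, h1, h2⟩ := hdir a ha b hb
    exact disjoint_left.1 hmax.prop.2 (hQ.or_elim hAx (hQ.imp_trans hAx ha' (hQ.thm h1))
      (hQ.imp_trans hAx hb' (hQ.thm h2)) h) hc
  · obtain ⟨a, ha⟩ := hI
    exact disjoint_left.1 hmax.prop.2 (hQ.mp (hQ.axGodel hAx (.exFalso a)) h) ha

end Theories

/-! ### Gödel valuations in linear orders -/

section Valuations

variable {Var : Type u} {Ax : Formula Var → Prop} {K : Type v} [LinearOrder K] [Zero K] [One K]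

/-- A Gödel homomorphism from formulas to the interval `[0,1]` of `K`, modal formulas being treated
as atoms, that takes the value `1` at the theorems. -/
structure IsVal (Ax : Formula Var → Prop) (v : Formula Var → K) : Prop where
  nonneg : ∀ θ, 0 ≤ v θ
  le_one : ∀ θ, v θ ≤ 1
  bot : v bot = 0
  and : ∀ θ ψ, v (and θ ψ) = v θ ⊓ v ψ
  or : ∀ θ ψ, v (or θ ψ) = v θ ⊔ v ψ
  imp_of_le : ∀ {θ ψ}, v θ ≤ v ψ → v (imp θ ψ) = 1
  imp_of_lt : ∀ {θ ψ}, v ψ < v θ → v (imp θ ψ) = v ψ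
  thm : ∀ {θ}, Deriv Ax ∅ θ → v θ = 1

namespace IsVal

variable {w : Formula Var → K} (hw : IsVal Ax w) {θ ψ χ : Formula Var}
include hw

theorem imp_eq_one_iff : w (imp θ ψ) = 1 ↔ w θ ≤ w ψ := by
  refine ⟨fun h => ?_, hw.imp_of_le⟩
  by_contra! hlt
  rw [hw.imp_of_lt hlt] at h
  exact absurd (hw.le_one θ) (not_le.2 (h ▸ hlt))

theorem le_of_thm (h : Deriv Ax ∅ (imp θ ψ)) : w θ ≤ w ψ := hw.imp_eq_one_iff.1 (hw.thm h)

theorem inf_le_of_le_imp (h : w θ ≤ w (imp ψ χ)) : w θ ⊓ w ψ ≤ w χ := by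
  rcases le_or_gt (w ψ) (w χ) with h' | h'
  · exact inf_le_right.trans h'
  · rw [hw.imp_of_lt h'] at h
    exact inf_le_left.trans h

theorem box_imp (hAx : ExtendsG Ax) : w (box (imp θ ψ)) ⊓ w (box θ) ≤ w (box ψ) :=
  hw.inf_le_of_le_imp (hw.le_of_thm (.ax (hAx _ (.kBox _ _))))

theorem dia_imp (hAx : ExtendsG Ax) : w (dia (imp θ ψ)) ⊓ w (box θ) ≤ w (dia ψ) :=
  hw.inf_le_of_le_imp (hw.le_of_thm (.ax (hAx _ (.fs1 _ _))))

theorem box_imp_eq_one (hAx : ExtendsG Ax) (h : w (dia θ) ≤ w (box ψ)) :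
    w (box (imp θ ψ)) = 1 := by
  have h1 := hw.le_of_thm (.ax (hAx _ (.fs2 θ ψ)))
  rw [hw.imp_of_le h] at h1
  exact le_antisymm (hw.le_one _) h1

theorem dia_bot (hAx : ExtendsG Ax) : w (dia .bot) = 0 := by
  have h1 := hw.le_of_thm (.ax (hAx _ .fDia))
  rw [hw.bot] at h1
  exact le_antisymm h1 (hw.nonneg _)

end IsVal

/-- An embedding of the Lindenbaum chain of a prime theory in `K` is a valuation. -/
theorem IsPrime.isVal (hAx : ExtendsG Ax) {Q : Set (Formula Var)} (hQ : IsPrime Ax Q)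
    {w : Formula Var → K} (hle : ∀ θ ψ, w θ ≤ w ψ ↔ imp θ ψ ∈ Q) (h0 : w bot = 0)
    (h1 : ∀ θ, w θ = 1 ↔ θ ∈ Q) : IsVal Ax w := by
  have ax : ∀ {θ}, AxGodel θ → θ ∈ Q := fun h => hQ.axGodel hAx h
  have top : ∀ θ, w θ ≤ 1 := fun θ => by
    rw [← (h1 (imp θ θ)).2 (hQ.imp_self hAx θ), hle]
    exact hQ.imp_intro hAx (hQ.imp_self hAx θ)
  refine ⟨fun θ => ?_, top, h0, fun θ ψ => ?_, fun θ ψ => ?_, fun {θ ψ} h => ?_,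
    fun {θ ψ} h => ?_, fun h => (h1 _).2 (hQ.thm h)⟩
  · rw [← h0, hle]; exact ax (.exFalso θ)
  · refine le_antisymm (le_inf ((hle _ _).2 (ax (.andLeft _ _))) ((hle _ _).2 (ax (.andRight _ _)))) ?_
    rcases le_total (w θ) (w ψ) with h | h
    · rw [inf_eq_left.2 h, hle]
      exact hQ.imp_mp hAx (ax (.andIntro _ _)) ((hle _ _).1 h)
    · rw [inf_eq_right.2 h, hle]
      exact hQ.imp_mp hAx (hQ.imp_trans hAx ((hle _ _).1 h) (ax (.andIntro _ _)))
        (hQ.imp_self hAx ψ)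
  · refine le_antisymm ?_ (sup_le ((hle _ _).2 (ax (.orLeft _ _))) ((hle _ _).2 (ax (.orRight _ _))))
    rcases le_total (w θ) (w ψ) with h | h
    · rw [sup_eq_right.2 h, hle]
      exact hQ.mp (hQ.mp (ax (.orElim _ _ _)) ((hle _ _).1 h)) (hQ.imp_self hAx ψ)
    · rw [sup_eq_left.2 h, hle]
      exact hQ.mp (hQ.mp (ax (.orElim _ _ _)) (hQ.imp_self hAx θ)) ((hle _ _).1 h)
  · rw [h1, ← hle]; exact h
  · refine le_antisymm ?_ ((hle _ _).2 (ax (.k _ _)))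
    have hn : imp θ ψ ∉ Q := fun hn => not_le.2 h ((hle _ _).2 hn)
    rw [hle]
    -- The first disjunct contracts to θ → ψ, which is excluded; the second yields (θ → ψ) → ψ.
    rcases hQ.or_mem (ax (.prelin θ (imp θ ψ))) with h' | h'
    · exact absurd (hQ.imp_mp hAx h' (hQ.imp_self hAx θ)) hn
    · exact hQ.imp_mp hAx (hQ.imp_self hAx _) h'

omit [Zero K] [One K] in
/-- The Lindenbaum chain of a prime theory embeds in a countably saturated order, subject to
countably many compatible bounds. -/
theorem IsPrime.exists_embedding [Nonempty K] [Countable (Formula Var)]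
    (hK : CountablySaturated K) (hAx : ExtendsG Ax) {Q : Set (Formula Var)} (hQ : IsPrime Ax Q)
    (l r : Set (Formula Var × K)) (hl : l.Countable) (hr : r.Countable)
    (hle : ∀ p ∈ l, ∀ q ∈ r, imp p.1 q.1 ∈ Q → p.2 ≤ q.2)
    (heq : ∀ p ∈ l, ∀ q ∈ r, p.2 = q.2 → imp q.1 p.1 ∈ Q) :
    ∃ w : Formula Var → K, (∀ θ ψ, w θ ≤ w ψ ↔ imp θ ψ ∈ Q) ∧
      (∀ p ∈ l, p.2 ≤ w p.1) ∧ ∀ q ∈ r, w q.1 ≤ q.2 := by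
  classical
  let _ : Preorder (Formula Var) :=
    { le := fun θ ψ => imp θ ψ ∈ Q
      le_refl := fun θ => hQ.imp_self hAx θ
      le_trans := fun _ _ _ h1 h2 => hQ.imp_trans hAx h1 h2 }
  have : Std.Total (α := Formula Var) (· ≤ ·) :=
    ⟨fun θ ψ => hQ.or_mem (hQ.axGodel hAx (.prelin θ ψ))⟩
  let D := Antisymmetrization (Formula Var) (· ≤ ·)
  let q : Formula Var → D := toAntisymmetrization (· ≤ ·)
  have hq : ∀ θ ψ, q θ ≤ q ψ ↔ imp θ ψ ∈ Q := fun θ ψ => Iff.rfl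
  have : Countable D := Quotient.countable
  -- A lower bound at a formula binds every class above it, and an upper bound every class below it;
  -- this makes the families monotone and antitone.
  obtain ⟨e, he, hb⟩ := hK.exists_strictMono (D := D)
    (fun d => Prod.snd '' {p ∈ l | q p.1 ≤ d}) (fun d => Prod.snd '' {p ∈ r | d ≤ q p.1})
    (fun d => (hl.mono (sep_subset _ _)).image _) (fun d => (hr.mono (sep_subset _ _)).image _)
    (fun d d' h => image_mono fun p hp => ⟨hp.1, hp.2.trans h⟩)
    (fun d d' h => image_mono fun p hp => ⟨hp.1, h.trans hp.2⟩)
    (by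
      rintro d _ ⟨p, ⟨hp, hp'⟩, rfl⟩ _ ⟨p', ⟨hr, hr'⟩, rfl⟩
      exact hle p hp p' hr ((hq _ _).1 (hp'.trans hr')))
    (by
      intro d d' hd
      refine disjoint_left.2 ?_
      rintro _ ⟨p, ⟨hp, hp'⟩, rfl⟩ ⟨p', ⟨hr, hr'⟩, h⟩
      have h2 := (hq _ _).2 (heq p hp p' hr h.symm)
      exact not_le.2 hd (hr'.trans (h2.trans hp')))
  exact ⟨fun θ => e (q θ), fun θ ψ => he.le_iff_le.trans (hq θ ψ),
    fun p hp => (hb _).1 _ ⟨p, ⟨hp, le_rfl⟩, rfl⟩, fun p hp => (hb _).2 _ ⟨p, ⟨hp, le_rfl⟩, rfl⟩⟩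

omit [Zero K] in
-- All members of `Q` are equivalent to ⊥ → ⊥ modulo `Q`, so fixing that one value fixes the whole
-- top class.
theorem IsPrime.eq_one_iff (hAx : ExtendsG Ax) {Q : Set (Formula Var)} (hQ : IsPrime Ax Q)
    {w : Formula Var → K} (hle : ∀ θ ψ, w θ ≤ w ψ ↔ imp θ ψ ∈ Q)
    (h1 : w (imp .bot .bot) = 1) (θ : Formula Var) : w θ = 1 ↔ θ ∈ Q := by
  have h := hQ.imp_self hAx .bot
  rw [← h1]
  refine ⟨fun hθ => hQ.mp ((hle _ _).1 hθ.ge) h, fun hθ => le_antisymm ?_ ?_⟩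
  · exact (hle _ _).2 (hQ.imp_intro hAx h)
  · exact (hle _ _).2 (hQ.imp_intro hAx hθ)

/-- A non-deducible formula is refuted by a valuation in a countably saturated order. -/
theorem exists_isVal_of_not_deriv [Countable (Formula Var)] (hK : CountablySaturated K)
    (h01 : (0 : K) < 1) (hAx : ExtendsG Ax) {T : Set (Formula Var)} {φ : Formula Var}
    (h : ¬ Deriv Ax T φ) :
    ∃ w : Formula Var → K, IsVal Ax w ∧ (∀ θ ∈ T, w θ = 1) ∧ w φ < 1 := by
  obtain ⟨Q, hTQ, hQ, hd⟩ := (isTheory_deriv (Ax := Ax) T).exists_isPrime hAx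
    (singleton_nonempty φ) (disjoint_singleton_right.2 h) (by
      rintro a rfl b rfl
      exact ⟨b, rfl, (isTheory_deriv _).imp_self hAx _, (isTheory_deriv _).imp_self hAx _⟩)
  have : Nonempty K := ⟨0⟩
  have htop : imp .bot .bot ∈ Q := hQ.imp_self hAx .bot
  -- The same two pairs serve as lower and upper bounds, pinning ⊥ to 0 and ⊥ → ⊥ to 1.
  have hc : ({(Formula.bot, 0), (imp .bot .bot, 1)} : Set (Formula Var × K)).Countable :=
    (countable_singleton _).insert _
  obtain ⟨w, hle, hl, hr⟩ := hQ.exists_embedding hK hAx _ _ hc hc (by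
      rintro p (rfl | rfl) q (rfl | rfl) hpq
      · exact le_rfl
      · exact h01.le
      · exact absurd (hQ.mp hpq htop) hQ.bot_notMem
      · exact le_rfl) (by
      rintro p (rfl | rfl) q (rfl | rfl) hpq
      · exact hQ.imp_self hAx _
      · exact absurd hpq h01.ne
      · exact absurd hpq h01.ne'
      · exact hQ.imp_self hAx _)
  have h1 := hQ.eq_one_iff hAx hle (le_antisymm (hr _ (Or.inr rfl)) (hl _ (Or.inr rfl)))
  have hw := hQ.isVal hAx hle (le_antisymm (hr _ (Or.inl rfl)) (hl _ (Or.inl rfl))) h1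
  exact ⟨w, hw, fun θ hθ => (h1 θ).2 (hTQ (.hyp hθ)),
    lt_of_le_of_ne (hw.le_one φ) fun h' => disjoint_right.1 hd rfl ((h1 φ).1 h')⟩

/-- The valuation `w'` is accessible from `w` with degree at least `s`. -/
def Rel (w w' : Formula Var → K) (s : K) : Prop :=
  ∀ θ, s ⊓ w (box θ) ≤ w' θ ∧ s ⊓ w' θ ≤ w (dia θ)

/-- Realization of a prime theory as an accessible valuation. -/
theorem IsVal.exists_rel [Countable (Formula Var)] (hK : CountablySaturated K)
    (hAx : ExtendsG Ax) {w : Formula Var → K} (hw : IsVal Ax w) {J : Set K}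
    (hJ : IsLowerSet J) (hJ1 : 1 ∉ J) {Q : Set (Formula Var)} (hQ : IsPrime Ax Q)
    (hbox : ∀ θ, w (box θ) ∉ J → θ ∈ Q) (hdia : ∀ θ, w (dia θ) ∈ J → θ ∉ Q)
    {s γ : K} (hsd : ∀ θ, w (dia θ) ∉ J → s ≤ w (dia θ))
    (hγ : ∀ c ∈ J, c < γ) {φ : Formula Var} (hφ : φ ∉ Q) :
    ∃ u : Formula Var → K, IsVal Ax u ∧ (∀ θ, u θ = 1 ↔ θ ∈ Q) ∧ Rel w u s ∧ u φ ≤ γ := by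
  have htop : imp .bot .bot ∈ Q := hQ.imp_self hAx .bot
  have hlt : ∀ {a b : K}, a ∈ J → b ∉ J → a < b := fun ha hb =>
    lt_of_not_ge fun h => hb (hJ h ha)
  have : Nonempty K := ⟨0⟩
  have hbot : w (box .bot) ∈ J := by_contra fun h => hQ.bot_notMem (hbox _ h)
  have hJ0 : (0 : K) ∈ J := hJ (hw.nonneg _) hbot
  -- Bounds from □ and ◇ are imposed only for values in `J`. When w(□θ) is outside `J`, θ is in `Q`
  -- and takes value 1; when w(◇θ) is outside `J`, it is at least `s`.
  obtain ⟨u, hle, hl, hr⟩ := hQ.exists_embedding (K := K) hK hAx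
    (insert (imp .bot .bot, 1) ((fun θ => (θ, w (box θ))) '' {θ | w (box θ) ∈ J}))
    (insert (imp .bot .bot, 1) (insert (φ, γ) ((fun θ => (θ, w (dia θ))) '' {θ | w (dia θ) ∈ J})))
    (((to_countable _).image _).insert _) ((((to_countable _).image _).insert _).insert _) (by
      rintro p (rfl | ⟨ψ, hψ, rfl⟩) q (rfl | rfl | ⟨θ, hθ, rfl⟩) hpq
      · exact le_rfl
      · exact absurd (hQ.mp hpq htop) hφ
      · exact absurd (hQ.mp hpq htop) (hdia _ hθ)
      · exact hw.le_one _
      · exact (hγ _ hψ).le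
      · change w (box ψ) ≤ w (dia θ)
        by_contra! hcon
        -- By `fs1`, a violation would put w(◇(ψ → θ)) in `J`, forcing ψ → θ out of `Q`.
        refine hdia (imp ψ θ) ?_ hpq
        have h1 := hw.dia_imp (θ := ψ) (ψ := θ) hAx
        refine hJ ?_ hθ
        rcases inf_le_iff.1 h1 with h | h
        · exact h
        · exact absurd h (not_le.2 hcon)) (by
      rintro p (rfl | ⟨ψ, hψ, rfl⟩) q (rfl | rfl | ⟨θ, hθ, rfl⟩) hpq
      · exact hQ.imp_self hAx _
      · exact hQ.imp_intro hAx htop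
      · exact hQ.imp_intro hAx htop
      · exact absurd (show (1 : K) ∈ J from (show w (box ψ) = 1 from hpq) ▸ hψ) hJ1
      · exact absurd hpq (hγ _ hψ).ne
      -- When w(◇θ) = w(□ψ), `fs2` gives □(θ → ψ) the value 1, so θ → ψ lies in `Q`.
      · refine hbox _ ?_
        have : w (dia θ) ≤ w (box ψ) := hpq.ge
        rw [hw.box_imp_eq_one hAx this]
        exact hJ1)
  have h1 := hQ.eq_one_iff hAx hle (le_antisymm (hr _ (Or.inl rfl)) (hl _ (Or.inl rfl)))
  -- Squeezed by 0 ≤ w(□⊥) ≤ u(⊥) ≤ w(◇⊥) = 0.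
  have h0 : u .bot = 0 := by
    have hd := hw.dia_bot hAx
    refine le_antisymm ?_ ((hw.nonneg _).trans (hl _ (Or.inr ⟨.bot, hbot, rfl⟩)))
    rw [← hd]
    exact hr _ (Or.inr (Or.inr ⟨.bot, by rw [mem_ofPred_eq, hd]; exact hJ0, rfl⟩))
  refine ⟨u, hQ.isVal hAx hle h0 h1, h1, fun θ => ⟨?_, ?_⟩, hr _ (Or.inr (Or.inl rfl))⟩
  · by_cases h : w (box θ) ∈ J
    · exact inf_le_right.trans (hl _ (Or.inr ⟨θ, h, rfl⟩))
    · rw [(h1 θ).2 (hbox θ h)]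
      exact inf_le_right.trans (hw.le_one _)
  · by_cases h : w (dia θ) ∈ J
    · exact inf_le_right.trans (hr _ (Or.inr (Or.inr ⟨θ, h, rfl⟩)))
    · exact inf_le_left.trans (hsd θ h)

/-- Approximate witnesses for the failure of a box. -/
theorem IsVal.exists_box_witness [Countable (Formula Var)] (hK : CountablySaturated K)
    (hAx : ExtendsG Ax) {w : Formula Var → K} (hw : IsVal Ax w)
    {C : Set K} (hC : C.Countable) {φ : Formula Var} (hφ : w (box φ) < 1) :
    ∃ (u : Formula Var → K) (s : K), IsVal Ax u ∧ Rel w u s ∧ u φ < s ∧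
      ∀ c ∈ C, w (box φ) < c → u φ < c := by
  obtain ⟨Q, hGQ, hQ, hd⟩ := (show IsTheory Ax {θ | w (box φ) < w (box θ)} from
    ⟨fun h => by
      change _ < _
      rwa [hw.thm (.necBox h)], fun h1 h2 => (lt_inf_iff.2 ⟨h1, h2⟩).trans_le
        (hw.box_imp hAx)⟩).exists_isPrime hAx
    (singleton_nonempty φ) (disjoint_singleton_right.2 (lt_irrefl _)) (by
      rintro a rfl b rfl
      exact ⟨b, rfl, (isTheory_deriv _).imp_self hAx _, (isTheory_deriv _).imp_self hAx _⟩)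
  have hφQ : φ ∉ Q := disjoint_right.1 hd rfl
  -- Saturation puts `s` just above w(□φ), below every larger value of `w` and element of `C`. Then
  -- `γ`, strictly between w(□φ) and `s`, caps u(φ).
  obtain ⟨s, hs1, hs2⟩ := hK {w (box φ)} {c ∈ C ∪ range w | w (box φ) < c}
    (countable_singleton _) ((hC.union (countable_range w)).mono (sep_subset _ _))
    (by rintro _ rfl b hb; exact hb.2)
  obtain ⟨γ, hγ1, hγ2⟩ := hK {w (box φ)} {s} (countable_singleton _) (countable_singleton _)
    (by rintro _ rfl _ rfl; exact hs1 _ rfl)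
  replace hs1 := hs1 _ rfl
  replace hγ1 := hγ1 _ rfl
  replace hγ2 := hγ2 _ rfl
  obtain ⟨u, hu, -, hR, huφ⟩ := hw.exists_rel hK hAx (J := Iic (w (box φ))) (isLowerSet_Iic _)
    (not_le.2 hφ) hQ (fun θ hθ => hGQ (not_le.1 hθ))
    -- If w(◇θ) ≤ w(□φ), then □(θ → φ) has value 1 by `fs2`, so θ in `Q` would put φ in `Q`.
    (fun θ hθ hθQ => hφQ (hQ.mp (hGQ (show _ < _ by rwa [hw.box_imp_eq_one hAx hθ])) hθQ))
    (s := s) (γ := γ)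
    (fun θ hθ => (hs2 _ ⟨Or.inr (mem_range_self _), not_le.1 hθ⟩).le)
    (fun c hc => hc.trans_lt hγ1) hφQ
  exact ⟨u, s, hu, hR, huφ.trans_lt hγ2, fun c hc hc' =>
    huφ.trans_lt (hγ2.trans (hs2 c ⟨Or.inl hc, hc'⟩))⟩

/-- Exact witnesses for a diamond. -/
theorem IsVal.exists_dia_witness [Countable (Formula Var)] (hK : CountablySaturated K)
    (hAx : ExtendsG Ax) {w : Formula Var → K} (hw : IsVal Ax w)
    {φ : Formula Var} (hφ : 0 < w (dia φ)) :
    ∃ u : Formula Var → K, IsVal Ax u ∧ Rel w u (w (dia φ)) ∧ u φ = 1 := by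
  have hth := isTheory_deriv (Ax := Ax) ∅
  obtain ⟨Q, hGQ, hQ, hd⟩ := (show IsTheory Ax {θ | w (dia φ) ≤ w (box (imp φ θ))} from
    ⟨fun h => by
      change _ ≤ _
      rw [hw.thm (.necBox (hth.imp_intro hAx h))]
      exact hw.le_one _, fun {θ ψ} h1 h2 => by
        change _ ≤ _
        have h3 : w (box (imp φ (imp θ ψ))) ≤ w (box (imp (imp φ θ) (imp φ ψ))) := by
          have h4 := hw.box_imp (θ := imp φ (imp θ ψ)) (ψ := imp (imp φ θ) (imp φ ψ)) hAx
          rwa [hw.thm (.necBox (hth.axGodel hAx (.s _ _ _))), inf_eq_right.2 (hw.le_one _)] at h4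
        exact (le_inf (h1.trans h3) h2).trans (hw.box_imp hAx)⟩).exists_isPrime hAx
    (I := {χ | w (dia χ) < w (dia φ)})
    ⟨.bot, by rw [mem_ofPred_eq, hw.dia_bot hAx]; exact hφ⟩
    -- Since φ → ((φ → χ) → χ) is a theorem, monotonicity of ◇ and `fs1` give min(w(◇φ), w(□(φ →
    -- χ))) ≤ w(◇χ).
    (disjoint_left.2 fun χ h1 h2 => by
      have h3 : Deriv Ax ∅ (imp φ (imp (imp φ χ) χ)) :=
        (hth.adjoin hAx φ).imp_mp hAx ((hth.adjoin hAx φ).imp_self hAx _)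
          ((hth.adjoin hAx φ).imp_intro hAx (hth.imp_self hAx φ))
      have h4 : w (dia φ) ≤ w (dia (imp (imp φ χ) χ)) := hw.le_of_thm (.monoDia h3)
      exact not_le.2 h2 ((le_inf h4 h1).trans (hw.dia_imp hAx)))
    (fun a ha b hb => ⟨Formula.or a b,
      (hw.le_of_thm (.ax (hAx _ (.kDia a b)))).trans_lt (by
        rw [hw.or]
        exact sup_lt_iff.2 ⟨ha, hb⟩),
      hth.axGodel hAx (.orLeft _ _), hth.axGodel hAx (.orRight _ _)⟩)
  obtain ⟨u, hu, hu1, hR, -⟩ := hw.exists_rel hK hAx (J := Iio (w (dia φ)))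
    (isLowerSet_Iio _) (not_lt.2 (hw.le_one _)) hQ
    (fun θ hθ => hGQ ((not_lt.1 hθ).trans (by
      have h4 := hw.box_imp (θ := θ) (ψ := imp φ θ) hAx
      rwa [hw.thm (.necBox (hth.axGodel hAx (.k _ _))), inf_eq_right.2 (hw.le_one _)] at h4)))
    (fun θ hθ => disjoint_right.1 hd hθ) (s := w (dia φ)) (γ := w (dia φ))
    (fun θ hθ => not_lt.1 hθ) (fun c hc => hc) hQ.bot_notMem
  refine ⟨u, hu, hR, (hu1 φ).2 (hGQ ?_)⟩
  rw [mem_ofPred_eq, hw.thm (.necBox (hth.imp_self hAx φ))]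
  exact hw.le_one _

end Valuations

/-! ### A saturated family of valuations -/

section Family

variable {Var : Type u} {Ax : Formula Var → Prop} {K : Type v} [LinearOrder K] [Zero K] [One K]

/-- A countable set of valuations together with a countable set of values. -/
structure Stage (Ax : Formula Var → Prop) (K : Type v) [LinearOrder K] [Zero K] [One K] where
  worlds : Set (Formula Var → K)
  values : Set K
  worlds_countable : worlds.Countable
  values_countable : values.Countable
  isVal : ∀ w ∈ worlds, IsVal Ax w

/-- The stage `P'` contains `P`, and all witnesses required by `P`. -/
structure Stage.Extends (P P' : Stage Ax K) : Prop where
  worlds_subset : P.worlds ⊆ P'.worlds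
  values_subset : P.values ⊆ P'.values
  apply_mem : ∀ w ∈ P.worlds, ∀ θ, w θ ∈ P'.values
  exists_btwn : ∀ a ∈ P.values, ∀ b ∈ P.values, a < b → ∃ c ∈ P'.values, a < c ∧ c < b
  exists_lt : ∀ a ∈ P.values, ∃ c ∈ P'.values, c < a
  exists_gt : ∀ a ∈ P.values, ∃ c ∈ P'.values, a < c
  box : ∀ w ∈ P.worlds, ∀ φ, w (box φ) < 1 → ∀ c ∈ P.values, w (box φ) < c →
    ∃ u ∈ P'.worlds, ∃ s ∈ P'.values, Rel w u s ∧ u φ < s ∧ u φ < c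
  dia : ∀ w ∈ P.worlds, ∀ φ, 0 < w (dia φ) → ∃ u ∈ P'.worlds, Rel w u (w (dia φ)) ∧ u φ = 1

theorem Stage.exists_extends [Countable (Formula Var)] (hK : CountablySaturated K)
    (hAx : ExtendsG Ax) (P : Stage Ax K) : ∃ P', P.Extends P' := by
  have hbox : ∀ (w : P.worlds) (φ : Formula Var), ∃ (u : Formula Var → K) (s : K), IsVal Ax u ∧
      (w.1 (Formula.box φ) < 1 → Rel w.1 u s ∧ u φ < s ∧
        ∀ c ∈ P.values, w.1 (Formula.box φ) < c → u φ < c) := by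
    intro w φ
    by_cases h : w.1 (Formula.box φ) < 1
    · obtain ⟨u, s, hu, h'⟩ := (P.isVal w w.2).exists_box_witness hK hAx P.values_countable h
      exact ⟨u, s, hu, fun _ => h'⟩
    · exact ⟨w, 0, P.isVal w w.2, fun h' => absurd h' h⟩
  have hdia : ∀ (w : P.worlds) (φ : Formula Var), ∃ u : Formula Var → K, IsVal Ax u ∧
      (0 < w.1 (Formula.dia φ) → Rel w.1 u (w.1 (Formula.dia φ)) ∧ u φ = 1) := by
    intro w φ
    by_cases h : 0 < w.1 (Formula.dia φ)
    · obtain ⟨u, hu, h'⟩ := (P.isVal w w.2).exists_dia_witness hK hAx h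
      exact ⟨u, hu, fun _ => h'⟩
    · exact ⟨w, P.isVal w w.2, fun h' => absurd h' h⟩
  have hbtw : ∀ a b : P.values, ∃ c : K, a.1 < b → a.1 < c ∧ c < b := by
    intro a b
    by_cases h : a.1 < b
    · obtain ⟨c, h1, h2⟩ := hK {a.1} {b.1} (countable_singleton _) (countable_singleton _)
        (by rintro _ rfl _ rfl; exact h)
      exact ⟨c, fun _ => ⟨h1 _ rfl, h2 _ rfl⟩⟩
    · exact ⟨0, fun h' => absurd h' h⟩
  obtain ⟨lo, -, hlo⟩ := hK ∅ P.values countable_empty P.values_countable (by simp)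
  obtain ⟨hi, hhi, -⟩ := hK P.values ∅ P.values_countable countable_empty (by simp)
  choose ub s hub hub' using hbox
  choose ud hud hud' using hdia
  choose m hm using hbtw
  have := P.worlds_countable.to_subtype
  have := P.values_countable.to_subtype
  refine ⟨⟨P.worlds ∪ range (fun p : P.worlds × Formula Var => ub p.1 p.2) ∪
    range (fun p : P.worlds × Formula Var => ud p.1 p.2),
    insert lo (insert hi (P.values ∪ range (fun p : P.worlds × Formula Var => s p.1 p.2) ∪
      range (fun p : P.worlds × Formula Var => p.1.1 p.2) ∪
      range (fun p : P.values × P.values => m p.1 p.2))),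
    (P.worlds_countable.union (countable_range _)).union (countable_range _),
    ((((P.values_countable.union (countable_range _)).union (countable_range _)).union
      (countable_range _)).insert _).insert _, ?_⟩, ?_⟩
  · rintro w ((hw | ⟨p, rfl⟩) | ⟨p, rfl⟩)
    exacts [P.isVal w hw, hub _ _, hud _ _]
  · constructor
    · exact fun w hw => Or.inl (Or.inl hw)
    · exact fun c hc => Or.inr (Or.inr (Or.inl (Or.inl (Or.inl hc))))
    · exact fun w hw θ => Or.inr (Or.inr (Or.inl (Or.inr ⟨(⟨w, hw⟩, θ), rfl⟩)))
    · exact fun a ha b hb hab => ⟨m ⟨a, ha⟩ ⟨b, hb⟩,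
        Or.inr (Or.inr (Or.inr ⟨(⟨a, ha⟩, ⟨b, hb⟩), rfl⟩)), hm ⟨a, ha⟩ ⟨b, hb⟩ hab⟩
    · exact fun a ha => ⟨lo, Or.inl rfl, hlo a ha⟩
    · exact fun a ha => ⟨hi, Or.inr (Or.inl rfl), hhi a ha⟩
    · intro w hw φ h c hc hc'
      obtain ⟨h1, h2, h3⟩ := hub' ⟨w, hw⟩ φ h
      exact ⟨ub ⟨w, hw⟩ φ, Or.inl (Or.inr ⟨(⟨w, hw⟩, φ), rfl⟩), s ⟨w, hw⟩ φ,
        Or.inr (Or.inr (Or.inl (Or.inl (Or.inr ⟨(⟨w, hw⟩, φ), rfl⟩)))), h1, h2, h3 c hc hc'⟩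
    · intro w hw φ h
      exact ⟨ud ⟨w, hw⟩ φ, Or.inr ⟨(⟨w, hw⟩, φ), rfl⟩, hud' ⟨w, hw⟩ φ h⟩

/-- Every stage is contained in one that contains its own witnesses. -/
theorem Stage.exists_extends_self [Countable (Formula Var)] (hK : CountablySaturated K)
    (hAx : ExtendsG Ax) (P : Stage Ax K) :
    ∃ P' : Stage Ax K, P.worlds ⊆ P'.worlds ∧ P.values ⊆ P'.values ∧ P'.Extends P' := by
  choose next hnext using fun P : Stage Ax K => P.exists_extends hK hAx
  let A : ℕ → Stage Ax K := fun n => next^[n] P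
  have hA : ∀ n, (A n).Extends (A (n + 1)) := fun n => by
    simp only [A, Function.iterate_succ_apply']
    exact hnext _
  have hW : Monotone fun n => (A n).worlds := monotone_nat_of_le_succ fun n => (hA n).worlds_subset
  have hC : Monotone fun n => (A n).values := monotone_nat_of_le_succ fun n => (hA n).values_subset
  have mW : ∀ {n w}, w ∈ (A n).worlds → w ∈ ⋃ n, (A n).worlds := fun h => mem_iUnion.2 ⟨_, h⟩
  have mC : ∀ {n c}, c ∈ (A n).values → c ∈ ⋃ n, (A n).values := fun h => mem_iUnion.2 ⟨_, h⟩
  refine ⟨⟨⋃ n, (A n).worlds, ⋃ n, (A n).values, countable_iUnion fun n => (A n).worlds_countable,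
    countable_iUnion fun n => (A n).values_countable, fun w hw => ?_⟩,
    fun w hw => mW (n := 0) hw, fun w hw => mC (n := 0) hw,
    fun w hw => hw, fun c hc => hc, fun w hw θ => ?_, fun a ha b hb hab => ?_, fun a ha => ?_,
    fun a ha => ?_, fun w hw φ hφ c hc hc' => ?_, fun w hw φ hφ => ?_⟩
  · obtain ⟨n, hn⟩ := mem_iUnion.1 hw
    exact (A n).isVal w hn
  · obtain ⟨n, hn⟩ := mem_iUnion.1 hw
    exact mC ((hA n).apply_mem w hn θ)
  · obtain ⟨n, hn⟩ := mem_iUnion.1 ha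
    obtain ⟨k, hk⟩ := mem_iUnion.1 hb
    obtain ⟨c, hc, h⟩ := (hA (max n k)).exists_btwn a (hC (le_max_left _ _) hn) b
      (hC (le_max_right _ _) hk) hab
    exact ⟨c, mC hc, h⟩
  · obtain ⟨n, hn⟩ := mem_iUnion.1 ha
    obtain ⟨c, hc, h⟩ := (hA n).exists_lt a hn
    exact ⟨c, mC hc, h⟩
  · obtain ⟨n, hn⟩ := mem_iUnion.1 ha
    obtain ⟨c, hc, h⟩ := (hA n).exists_gt a hn
    exact ⟨c, mC hc, h⟩
  · obtain ⟨n, hn⟩ := mem_iUnion.1 hw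
    obtain ⟨k, hk⟩ := mem_iUnion.1 hc
    -- The box witness depends on `c`, so it is taken at a stage containing both `w` and `c`.
    obtain ⟨u, hu, s, hs, h⟩ := (hA (max n k)).box w (hW (le_max_left _ _) hn) φ hφ c
      (hC (le_max_right _ _) hk) hc'
    exact ⟨u, mW hu, s, mC hs, h⟩
  · obtain ⟨n, hn⟩ := mem_iUnion.1 hw
    obtain ⟨u, hu, h⟩ := (hA n).dia w hn φ hφ
    exact ⟨u, mW hu, h⟩

end Family

/-! ### Canonical models -/

section Canonical

variable {Var : Type u}

/-- The canonical model on a set of `[0,1]`-valued valuations. -/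
noncomputable def canonicalModel (W : Set (Formula Var → unitInterval)) (hW : W.Nonempty) :
    GKModel Var where
  World := W
  nonempty := hW.to_subtype
  S x y := ⨅ θ, (x.1 (box θ) ⇨ y.1 θ) ⊓ (y.1 θ ⇨ x.1 (dia θ))
  e x p := x.1 (var p)

/-- The right side is `Rel` over `[0,1]`, so a witness in the saturated order with degree `s`
transfers to a lower bound on `S`. -/
theorem canonicalModel_le_S {W : Set (Formula Var → unitInterval)} {hW : W.Nonempty}
    {x y : W} {s : unitInterval} :
    s ≤ (canonicalModel W hW).S x y ↔
      ∀ θ, s ⊓ x.1 (box θ) ≤ y.1 θ ∧ s ⊓ y.1 θ ≤ x.1 (dia θ) := by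
  simp only [canonicalModel, le_iInf_iff, le_inf_iff, le_himp_iff]

theorem canonicalModel_S_box {W : Set (Formula Var → unitInterval)} {hW : W.Nonempty}
    (x y : W) (θ : Formula Var) : (canonicalModel W hW).S x y ⊓ x.1 (box θ) ≤ y.1 θ :=
  (canonicalModel_le_S.1 le_rfl θ).1

theorem canonicalModel_S_dia {W : Set (Formula Var → unitInterval)} {hW : W.Nonempty}
    (x y : W) (θ : Formula Var) : (canonicalModel W hW).S x y ⊓ y.1 θ ≤ x.1 (dia θ) :=
  (canonicalModel_le_S.1 le_rfl θ).2

/-- The truth lemma. -/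
theorem canonicalModel_val {Ax : Formula Var → Prop} {W : Set (Formula Var → unitInterval)}
    {hW : W.Nonempty} (hval : ∀ w ∈ W, IsVal Ax w)
    (hbox : ∀ x : W, ∀ φ, ∀ b, x.1 (box φ) < b → ∃ y : W,
      y.1 φ < (canonicalModel W hW).S x y ∧ y.1 φ < b)
    (hdia : ∀ x : W, ∀ φ, 0 < x.1 (dia φ) → ∃ y : W,
      x.1 (dia φ) ≤ (canonicalModel W hW).S x y ∧ y.1 φ = 1)
    (x : W) (φ : Formula Var) : (canonicalModel W hW).val x φ = x.1 φ := by
  induction φ generalizing x with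
  | var p => rfl
  | bot => exact (hval x x.2).bot.symm
  | and φ ψ h1 h2 => simp only [GKModel.val]; rw [h1, h2, (hval x x.2).and]
  | or φ ψ h1 h2 => simp only [GKModel.val]; rw [h1, h2, (hval x x.2).or]
  | imp φ ψ h1 h2 =>
    simp only [GKModel.val]
    rw [h1, h2, unitInterval_himp_eq]
    split_ifs with h
    · exact ((hval x x.2).imp_of_le h).symm
    · exact ((hval x x.2).imp_of_lt (not_le.1 h)).symm
  | box φ ih =>
    refine le_antisymm ?_ (le_iInf fun y => ?_)
    · by_contra! hlt
      -- Taking `b` to be the model's value of □φ gives a contradiction: as y(φ) < S(x,y), the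
      -- implication at `y` equals y(φ), which is below `b`.
      obtain ⟨y, hy1, hy2⟩ := hbox x φ _ hlt
      refine not_le.2 hy2 ((iInf_le _ y).trans ?_)
      rw [unitInterval_himp_eq, ih, if_neg (not_le.2 hy1)]
    · rw [ih y, le_himp_iff, inf_comm]
      exact canonicalModel_S_box x y φ
  | dia φ ih =>
    refine le_antisymm (iSup_le fun y => ?_) ?_
    · rw [ih y]
      exact canonicalModel_S_dia x y φ
    · rcases eq_or_lt_of_le (unitInterval.nonneg' (t := x.1 (dia φ))) with h | h
      · rw [← h]; exact unitInterval.nonneg'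
      · obtain ⟨y, hy1, hy2⟩ := hdia x φ h
        refine le_trans ?_ (le_iSup _ y)
        rw [ih y, hy2]
        exact le_inf hy1 unitInterval.le_one'

theorem canonicalModel_mem_Ref {Ax : Formula Var → Prop} {W : Set (Formula Var → unitInterval)}
    {hW : W.Nonempty} (hval : ∀ w ∈ W, IsVal Ax w) (hT : ∀ θ, AxGT θ → Ax θ) :
    canonicalModel W hW ∈ Ref Var := fun x =>
  le_antisymm unitInterval.le_one' (canonicalModel_le_S.2 fun θ =>
    ⟨inf_le_right.trans ((hval x.1 x.2).le_of_thm (.ax (hT _ (.tBox θ)))),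
      inf_le_right.trans ((hval x.1 x.2).le_of_thm (.ax (hT _ (.tDia θ))))⟩)

theorem canonicalModel_mem_Trans {Ax : Formula Var → Prop} {W : Set (Formula Var → unitInterval)}
    {hW : W.Nonempty} (hval : ∀ w ∈ W, IsVal Ax w) (h4 : ∀ θ, AxGS4 θ → Ax θ) :
    canonicalModel W hW ∈ Trans Var := fun x y z =>
  canonicalModel_le_S.2 fun θ => by
    constructor
    · have h1 := (hval x.1 x.2).le_of_thm (.ax (h4 _ (.fourBox θ)))
      have h2 := canonicalModel_S_box (hW := hW) x y (box θ)
      have h3 := canonicalModel_S_box (hW := hW) y z θ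
      exact (le_inf (inf_le_left.trans inf_le_right)
        ((inf_le_inf inf_le_left h1).trans h2)).trans h3
    · have h1 := (hval x.1 x.2).le_of_thm (.ax (h4 _ (.fourDia θ)))
      have h2 := canonicalModel_S_dia (hW := hW) x y (dia θ)
      have h3 := canonicalModel_S_dia (hW := hW) y z θ
      exact (le_inf (inf_le_left.trans inf_le_left)
        ((inf_le_inf inf_le_right le_rfl).trans h3)).trans (h2.trans h1)

/-- One inequality suffices: `m2` turns x(◇□θ) into x(θ), giving the □-bound for the pair (y,x), and
`m1` gives the ◇-bound. -/
theorem canonicalModel_mem_Symm {Ax : Formula Var → Prop} {W : Set (Formula Var → unitInterval)}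
    {hW : W.Nonempty} (hval : ∀ w ∈ W, IsVal Ax w) (h5 : ∀ θ, AxGS5 θ → Ax θ) :
    canonicalModel W hW ∈ Symm Var := by
  have key : ∀ x y : W, (canonicalModel W hW).S x y ≤ (canonicalModel W hW).S y x := fun x y =>
    canonicalModel_le_S.2 fun θ =>
      ⟨(canonicalModel_S_dia x y (box θ)).trans
        ((hval x.1 x.2).le_of_thm (.ax (h5 _ (.m2 θ)))),
      (inf_le_inf_left _ ((hval x.1 x.2).le_of_thm (.ax (h5 _ (.m1 θ))))).trans
        (canonicalModel_S_box x y (dia θ))⟩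
  exact fun x y => le_antisymm (key x y) (key y x)

/-- A non-deducible formula is refuted in a canonical model. -/
theorem exists_canonicalModel {Ax : Formula ℕ → Prop} (hAx : ExtendsG Ax) {T : Set (Formula ℕ)}
    {φ : Formula ℕ} (h : ¬ Deriv Ax T φ) :
    ∃ (W : Set (Formula ℕ → unitInterval)) (hW : W.Nonempty), (∀ w ∈ W, IsVal Ax w) ∧
      ∃ x : W, (∀ θ ∈ T, (canonicalModel W hW).val x θ = 1) ∧
        (canonicalModel W hW).val x φ ≠ 1 := by
  have hK := HyperRat.countablySaturated
  have h01 : (0 : HyperRat) < 1 := zero_lt_one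
  obtain ⟨w₀, hw₀, hT, hφ⟩ := exists_isVal_of_not_deriv hK h01 hAx h
  obtain ⟨P, hPw, hPv, hP⟩ := Stage.exists_extends_self hK hAx
    ⟨{w₀}, {0, 1}, countable_singleton _, (countable_singleton _).insert _,
      by rintro w rfl; exact hw₀⟩
  obtain ⟨g, g0, g1, gmono, gdense⟩ := exists_dense_map_unitInterval P.values_countable
    hP.exists_btwn hP.exists_lt hP.exists_gt (hPv (Or.inl rfl)) (hPv (Or.inr rfl)) h01
  have hmem : ∀ w ∈ P.worlds, ∀ θ, w θ ∈ P.values ∩ Icc 0 1 := fun w hw θ =>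
    ⟨hP.apply_mem w hw θ, (P.isVal w hw).nonneg θ, (P.isVal w hw).le_one θ⟩
  have glt : ∀ w ∈ P.worlds, ∀ u ∈ P.worlds, ∀ θ ψ, w θ < u ψ ↔ g (w θ) < g (u ψ) :=
    fun w hw u hu θ ψ => (gmono.lt_iff_lt (hmem w hw θ) (hmem u hu ψ)).symm
  have gle : ∀ w ∈ P.worlds, ∀ u ∈ P.worlds, ∀ θ ψ, w θ ≤ u ψ ↔ g (w θ) ≤ g (u ψ) :=
    fun w hw u hu θ ψ => (gmono.le_iff_le (hmem w hw θ) (hmem u hu ψ)).symm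
  have hval : ∀ w ∈ (fun w => g ∘ w) '' P.worlds, IsVal Ax w := by
    rintro _ ⟨w, hw, rfl⟩
    have hv := P.isVal w hw
    refine ⟨fun _ => unitInterval.nonneg', fun _ => unitInterval.le_one', ?_, fun θ ψ => ?_,
      fun θ ψ => ?_, fun {θ ψ} h => ?_, fun {θ ψ} h => ?_, fun {θ} h => ?_⟩
    · simp only [Function.comp, hv.bot, g0]
    · simp only [Function.comp, hv.and]
      exact gmono.monotoneOn.map_inf (hmem w hw θ) (hmem w hw ψ)
    · simp only [Function.comp, hv.or]
      exact gmono.monotoneOn.map_sup (hmem w hw θ) (hmem w hw ψ)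
    · simp only [Function.comp, hv.imp_of_le ((gle w hw w hw θ ψ).2 h), g1]
    · simp only [Function.comp, hv.imp_of_lt ((glt w hw w hw ψ θ).2 h)]
    · simp only [Function.comp, hv.thm h, g1]
  have ginf : ∀ s ∈ P.values ∩ Icc 0 1, ∀ w ∈ P.worlds, ∀ u ∈ P.worlds, ∀ θ ψ,
      s ⊓ w θ ≤ u ψ → g s ⊓ g (w θ) ≤ g (u ψ) := fun s hs w hw u hu θ ψ h => by
    rw [inf_le_iff] at h ⊢
    exact h.imp (gmono.le_iff_le hs (hmem u hu ψ)).2 (gle w hw u hu θ ψ).1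
  have hW : ((fun w => g ∘ w) '' P.worlds).Nonempty := ⟨_, mem_image_of_mem _ (hPw rfl)⟩
  have hrel : ∀ w (hw : w ∈ P.worlds) u (hu : u ∈ P.worlds) (s), s ∈ P.values ∩ Icc 0 1 →
      Rel w u s → g s ≤ (canonicalModel _ hW).S ⟨_, mem_image_of_mem _ hw⟩
        ⟨_, mem_image_of_mem _ hu⟩ := fun w hw u hu s hs h =>
    canonicalModel_le_S.2 fun θ =>
      ⟨ginf s hs w hw u hu _ _ (h θ).1, ginf s hs u hu w hw _ _ (h θ).2⟩
  have truth := canonicalModel_val (hW := hW) hval (by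
      rintro ⟨_, w, hw, rfl⟩ φ b hb
      -- Density replaces the arbitrary `b` by the image of a value `c` of the family, for which a
      -- box witness is available.
      obtain ⟨c, hc, hc1, hc2⟩ := gdense _ b hb
      have hlt : w (box φ) < c := (gmono.lt_iff_lt (hmem w hw _) hc).1 hc1
      obtain ⟨u, hu, s, hs, hR, hus, huc⟩ := hP.box w hw φ (hlt.trans_le hc.2.2) c hc.1 hlt
      -- `s` is truncated at 1 because `g` is strictly monotone only on values between 0 and 1.
      have hs0 : min s 1 ∈ P.values ∩ Icc 0 1 := by
        rcases le_total s 1 with h | h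
        · rw [min_eq_left h]
          exact ⟨hs, (hmem u hu φ).2.1.trans hus.le, h⟩
        · rw [min_eq_right h]
          exact ⟨hPv (Or.inr rfl), h01.le, le_rfl⟩
      have hus' : u φ < min s 1 := lt_min hus (huc.trans_le hc.2.2)
      have hR' : Rel w u (min s 1) := fun θ =>
        ⟨(inf_le_inf_right _ (min_le_left _ _)).trans (hR θ).1,
          (inf_le_inf_right _ (min_le_left _ _)).trans (hR θ).2⟩
      exact ⟨⟨_, mem_image_of_mem _ hu⟩,
        (gmono (hmem u hu φ) hs0 hus').trans_le (hrel w hw u hu _ hs0 hR'),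
        (gmono (hmem u hu φ) hc huc).trans hc2⟩) (by
      rintro ⟨_, w, hw, rfl⟩ φ hφ
      have hpos : 0 < w (dia φ) :=
        (gmono.lt_iff_lt ⟨hPv (Or.inl rfl), le_rfl, h01.le⟩ (hmem w hw _)).1 (by rw [g0]; exact hφ)
      obtain ⟨u, hu, hR, h1⟩ := hP.dia w hw φ hpos
      exact ⟨⟨_, mem_image_of_mem _ hu⟩, hrel w hw u hu _ (hmem w hw _) hR,
        by simp only [Function.comp, h1, g1]⟩)
  refine ⟨_, hW, hval, ⟨_, mem_image_of_mem _ (hPw rfl)⟩, fun θ hθ => ?_, ?_⟩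
  · rw [truth]
    simp only [Function.comp, hT θ hθ, g1]
  · rw [truth]
    refine ne_of_lt ?_
    rw [← g1]
    exact gmono (hmem w₀ (hPw rfl) φ) ⟨hPv (Or.inr rfl), h01.le, le_rfl⟩ hφ

end Canonical

/-! ### Strong completeness -/

/-- Strong completeness for countable theories over any set of variables, reduced to canonical
models over countably many variables. -/
theorem deriv_of_entails {Var : Type u} {Ax : Formula Var → Prop} {Ax' : Formula ℕ → Prop}
    (hAx' : ExtendsG Ax') (hsubst : ∀ (σ : ℕ → Formula Var) φ, Ax' φ → Ax (φ.subst σ))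
    {C : Set (GKModel.{u, v} Var)}
    (hC : ∀ (W : Set (Formula ℕ → unitInterval)) (hW : W.Nonempty) (f : Var → ℕ),
      (∀ w ∈ W, IsVal Ax' w) → (canonicalModel W hW).rename f ∈ C)
    {T : Set (Formula Var)} (hT : T.Countable) {φ : Formula Var} (h : Entails C T φ) :
    Deriv Ax T φ := by
  classical
  let V : Set Var := φ.vars ∪ ⋃ θ ∈ T, θ.vars
  have hV : V.Countable := φ.vars_countable.union (hT.biUnion fun θ _ => θ.vars_countable)
  obtain ⟨f, hf⟩ := countable_iff_exists_injOn.1 hV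
  -- Inverts `f` on the variables that occur in `T` and φ; other numbers go to ⊥, which is harmless
  -- because axioms are closed under every substitution.
  let σ : ℕ → Formula Var := fun n => if h : ∃ p ∈ V, f p = n then var h.choose else bot
  have hσ : ∀ p ∈ V, σ (f p) = var p := fun p hp => by
    have hex : ∃ q ∈ V, f q = f p := ⟨p, hp, rfl⟩
    simp only [σ, dif_pos hex]
    rw [hf hex.choose_spec.1 hp hex.choose_spec.2]
  let ρ : Formula Var → Formula ℕ := Formula.subst fun p => var (f p)
  have hφ : (ρ φ).subst σ = φ := subst_subst_of_vars fun p hp => hσ p (Or.inl hp)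
  have hTσ : Formula.subst σ '' (ρ '' T) = T := by
    rw [image_image]
    refine (image_congr fun θ hθ => ?_).trans (image_id T)
    exact subst_subst_of_vars fun p hp => hσ p (Or.inr (mem_biUnion hθ hp))
  by_contra hcon
  have hcon' : ¬ Deriv Ax' (ρ '' T) (ρ φ) := fun hd => hcon (by
    have := hd.subst σ (hsubst σ)
    rwa [hφ, hTσ] at this)
  obtain ⟨W, hW, hval, x, hx, hxφ⟩ := exists_canonicalModel hAx' hcon'
  have hr := GKModel.val_rename.{v} f (canonicalModel W hW) x
  exact hxφ ((hr φ).symm.trans (h _ (hC W hW f hval) ⟨x⟩ fun θ hθ =>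
    (hr θ).trans (hx _ (mem_image_of_mem _ hθ))))

end BiModal

theorem mainTheorem2 {Var : Type u} (T : Set (BiModal.Formula Var)) (hT : T.Countable)
    (φ : BiModal.Formula Var) :
    (BiModal.Deriv BiModal.AxGT T φ ↔
      BiModal.Entails (BiModal.Ref.{u, v} Var) T φ) ∧
    (BiModal.Deriv BiModal.AxGS4 T φ ↔
      BiModal.Entails (BiModal.Ref.{u, v} Var ∩ BiModal.Trans.{u, v} Var) T φ) ∧
    (BiModal.Deriv BiModal.AxGS5 T φ ↔
      BiModal.Entails
        (BiModal.Ref.{u, v} Var ∩ BiModal.Trans.{u, v} Var ∩ BiModal.Symm.{u, v} Var) T φ) := by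
  open BiModal in
  refine ⟨⟨fun h M hM x hx => h.sound (fun _ hφ => hφ.sound hM) x hx, fun h => ?_⟩,
    ⟨fun h M hM x hx => h.sound (fun _ hφ => hφ.sound hM) x hx, fun h => ?_⟩,
    ⟨fun h M hM x hx => h.sound (fun _ hφ => hφ.sound hM) x hx, fun h => ?_⟩⟩
  · refine deriv_of_entails (Ax' := AxGT) (fun _ h => .base h) (fun σ _ h => h.subst σ)
      (fun W hW f hval => ?_) hT h
    have hR := canonicalModel_mem_Ref (hW := hW) hval fun _ h => h
    exact fun x => hR x.down
  · refine deriv_of_entails (Ax' := AxGS4) (fun _ h => .base (.base h)) (fun σ _ h => h.subst σ)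
      (fun W hW f hval => ?_) hT h
    have hR := canonicalModel_mem_Ref (hW := hW) hval fun _ h => .base h
    have hTr := canonicalModel_mem_Trans (hW := hW) hval fun _ h => h
    exact ⟨fun x => hR x.down, fun x y z => hTr x.down y.down z.down⟩
  · refine deriv_of_entails (Ax' := AxGS5) (fun _ h => .base (.base (.base h)))
      (fun σ _ h => h.subst σ) (fun W hW f hval => ?_) hT h
    have hR := canonicalModel_mem_Ref (hW := hW) hval fun _ h => .base (.base h)
    have hTr := canonicalModel_mem_Trans (hW := hW) hval fun _ h => .base h
    have hS := canonicalModel_mem_Symm (hW := hW) hval fun _ h => h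
    exact ⟨⟨fun x => hR x.down, fun x y z => hTr x.down y.down z.down⟩,
      fun x y => hS x.down y.down⟩
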